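/- For a discrete group $G$ let $C^*(G)$ be its full group C*-algebra. For $d\ge 1$ let $\mathrm{NC}(d)=\mathrm{Span}\{1,u_1,\dots,u_d\}\subseteq C^*(\mathbb Z_2*\cdots*\mathbb Z_2)$ ($d$ free factors), where $u_j$ is the canonical unitary given by the generator of the $j$-th copy of $\mathbb Z_2$. For $k\ge 1$ let $\mathrm{NCP}(k)=\mathrm{Span}\{1,w,w^2,\dots,w^{k-1},v\}\subseteq C^*(\mathbb Z_k*\mathbb Z_2)$, where $w$ and $v$ are the canonical unitaries given by the generators of $\mathbb Z_k$ and $\mathbb Z_2$. A C*-cover of an operator system $R$ is a unital complete order embedding $\kappa:R\to A$ into a unital C*-algebra $A$ generated, as a C*-algebra, by $\kappa(R)$. A C*-envelope of $R$ is a C*-cover $\iota:R\to C^*_e(R)$ such that for every C*-cover $\kappa:R\to A$ there is a unital $*$-homomorphism $\pi:A\to C^*_e(R)$ with $\pi\circ\kappa=\iota$. **Theorem.** Let $R$ be $\mathrm{NC}(d)$ for some $d\ge 1$, or $\mathrm{NCP}(k)$ for some $k\ge 1$. Then $R$ has a C*-envelope, and for every C*-envelope $\iota:R\to C^*_e(R)$,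 every complex Hilbert space $H$ and every unital completely positive map $\varphi:R\to B(H)$, there is a unital completely positive map $\Phi:C^*_e(R)\to\varphi(R)''$ with $\Phi\circ\iota=\varphi$. Here $\varphi(R)''\subseteq B(H)$ is the double commutant of $\varphi(R)$, i.e. the von Neumann algebra generated by $\varphi(R)$. -/

import Mathlib

universe v w

noncomputable section

namespace NCCube

open UniformSpace

/-! ### Matrix positivity, operator systems, ucp maps, C*-envelopes -/

/-- Positivity of a square matrix over a C*-algebra `A`, i.e. positivity in the C*-algebra
`M_n(A)`: the matrix is of the form `Nᴴ * N`. -/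
def MatPos {A : Type*} [NonUnitalSemiring A] [Star A] {n : ℕ}
    (M : Matrix (Fin n) (Fin n) A) : Prop :=
  ∃ N : Matrix (Fin n) (Fin n) A, M = N.conjTranspose * N

theorem nonneg_iff_aux {C : Type*} [NonUnitalCStarAlgebra C] [PartialOrder C] [StarOrderedRing C]
    (a : C) : 0 ≤ a ↔ ∃ b, a = star b * b :=
  CStarAlgebra.nonneg_iff_eq_star_mul_self

/-- `MatPos` is positivity for Mathlib's order on the C*-algebra `M_n(A)`. -/
theorem matPos_iff_nonneg {A : Type*} [CStarAlgebra A] [PartialOrder A] [StarOrderedRing A]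
    {n : ℕ} (M : Matrix (Fin n) (Fin n) A) : MatPos M ↔ 0 ≤ CStarMatrix.ofMatrix M := by
  exact (nonneg_iff_aux (CStarMatrix.ofMatrix M)).symm

/-- An operator system in a unital C*-algebra `A`: a linear subspace that contains the unit and
is closed under the involution. Its matrix cones are inherited from `A`. -/
structure OpSystem (A : Type*) [CStarAlgebra A] extends Submodule ℂ A where
  one_mem' : (1 : A) ∈ carrier
  star_mem' : ∀ a ∈ carrier, star a ∈ carrier

namespace OpSystem

variable {A : Type*} [CStarAlgebra A]

/-- The elements of an operator system, as a complex vector space. -/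
abbrev Elt (R : OpSystem A) : Type _ := R.toSubmodule

/-- The distinguished order unit of an operator system. -/
def unit (R : OpSystem A) : R.Elt := ⟨1, R.one_mem'⟩

/-- Positivity of matrices over an operator system. -/
def Pos (R : OpSystem A) {n : ℕ} (M : Matrix (Fin n) (Fin n) R.Elt) : Prop :=
  MatPos (M.map fun x => (x : A))

/-- Unital completely positive maps from an operator system to a C*-algebra. -/
structure IsUCP (R : OpSystem A) {B : Type*} [CStarAlgebra B] (φ : R.Elt →ₗ[ℂ] B) : Prop where
  map_unit : φ R.unit = 1
  map_pos : ∀ (n : ℕ) (M : Matrix (Fin n) (Fin n) R.Elt), R.Pos M → MatPos (M.map φ)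

/-- A C*-cover of `R`: a unital complete order embedding `κ` of `R` into a unital C*-algebra `B`
that is generated, as a C*-algebra, by the image of `κ`. -/
structure IsCStarCover (R : OpSystem A) {B : Type*} [CStarAlgebra B] (κ : R.Elt →ₗ[ℂ] B) :
    Prop where
  map_unit : κ R.unit = 1
  map_pos_iff : ∀ (n : ℕ) (M : Matrix (Fin n) (Fin n) R.Elt), MatPos (M.map κ) ↔ R.Pos M
  generates : (StarAlgebra.adjoin ℂ (Set.range κ)).topologicalClosure = ⊤

/-- The C*-envelope of `R`: a minimal C*-cover, i.e. one that is a quotient, compatibly with the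
embeddings, of every C*-cover of `R`. A C*-cover of `R` always has a copy in the universe of `A`,
so it suffices to let the other covers range over that universe. -/
structure IsCStarEnvelope.{a, b} {A : Type a} [CStarAlgebra A] (R : OpSystem A) {B : Type b}
    [CStarAlgebra B] (ι : R.Elt →ₗ[ℂ] B) : Prop where
  isCover : R.IsCStarCover ι
  minimal : ∀ (C : Type a) [CStarAlgebra C] (κ : R.Elt →ₗ[ℂ] C), R.IsCStarCover κ →
    ∃ π : C →⋆ₐ[ℂ] B, ∀ x, π (κ x) = ι x

end OpSystem

/-- Unital completely positive maps between unital C*-algebras. -/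
structure IsUCPMap {A B : Type*} [CStarAlgebra A] [CStarAlgebra B] (Φ : A →ₗ[ℂ] B) : Prop where
  map_one : Φ 1 = 1
  map_pos : ∀ (n : ℕ) (M : Matrix (Fin n) (Fin n) A), MatPos M → MatPos (M.map Φ)

/-! ### The full group C*-algebra of a discrete group -/

/-- The complex group algebra of `G`. -/
def GroupAlg (G : Type*) [Group G] : Type _ := MonoidAlgebra ℂ G

namespace GroupAlg

variable {G : Type*} [Group G]

instance : Ring (GroupAlg G) := inferInstanceAs (Ring (MonoidAlgebra ℂ G))

instance : Algebra ℂ (GroupAlg G) := inferInstanceAs (Algebra ℂ (MonoidAlgebra ℂ G))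

/-- The element `a • g` of the group algebra. -/
def single (g : G) (a : ℂ) : GroupAlg G := MonoidAlgebra.single g a

theorem single_zero (g : G) : single g 0 = 0 := MonoidAlgebra.single_zero g

theorem single_add (g : G) (a b : ℂ) : single g (a + b) = single g a + single g b :=
  MonoidAlgebra.single_add g a b

theorem single_mul_single (g h : G) (a b : ℂ) :
    single g a * single h b = single (g * h) (a * b) :=
  MonoidAlgebra.single_mul_single g h a b

theorem one_def : (1 : GroupAlg G) = single 1 1 := rfl

theorem smul_single (c : ℂ) (g : G) (a : ℂ) : c • single g a = single g (c * a) :=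
  MonoidAlgebra.smul_single c g a

theorem ind {P : GroupAlg G → Prop} (x : GroupAlg G) (zero : P 0)
    (add : ∀ x y, P x → P y → P (x + y)) (single : ∀ g a, P (single g a)) : P x :=
  MonoidAlgebra.induction_linear (motive := P) x zero add single

/-- The involution `(∑ a_g g)* = ∑ conj(a_g) g⁻¹` of the group algebra. -/
def starFun (f : GroupAlg G) : GroupAlg G :=
  (MonoidAlgebra.coeff f).sum fun g a => single g⁻¹ (star a)

theorem starFun_single (g : G) (a : ℂ) : starFun (single g a) = single g⁻¹ (star a) :=
  Finsupp.sum_single_index (by simp [single_zero])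

theorem starFun_add (x y : GroupAlg G) : starFun (x + y) = starFun x + starFun y :=
  Finsupp.sum_add_index' (by simp [single_zero]) (by simp [single_add])

theorem starFun_zero : starFun (0 : GroupAlg G) = 0 := Finsupp.sum_zero_index

instance : StarRing (GroupAlg G) where
  star := starFun
  star_involutive x := by
    induction x using ind with
    | zero => simp [starFun_zero]
    | add x y hx hy => rw [starFun_add, starFun_add, hx, hy]
    | single g a => simp [starFun_single]
  star_add := starFun_add
  star_mul x y := by
    change starFun (x * y) = starFun y * starFun x
    induction x using ind with
    | zero => simp [starFun_zero]
    | add x x' hx hx' => rw [add_mul, starFun_add, hx, hx', starFun_add, mul_add]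
    | single g a =>
      induction y using ind with
      | zero => simp [starFun_zero]
      | add y y' hy hy' => rw [mul_add, starFun_add, hy, hy', starFun_add, add_mul]
      | single h b =>
        rw [single_mul_single, starFun_single, starFun_single, starFun_single,
          single_mul_single, mul_inv_rev, star_mul]

theorem star_single (g : G) (a : ℂ) : star (single g a) = single g⁻¹ (star a) :=
  starFun_single g a

instance : StarModule ℂ (GroupAlg G) where
  star_smul c x := by
    induction x using ind with
    | zero => simp
    | add x y hx hy => rw [smul_add, star_add, hx, hy, star_add, smul_add]
    | single g a => rw [smul_single, star_single, star_single, smul_single, star_mul, mul_comm]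

end GroupAlg

/-- C*-seminorms on a complex unital *-algebra. -/
structure CStarSeminorm (A : Type*) [Ring A] [StarRing A] [Algebra ℂ A] extends
    Seminorm ℂ A where
  mul_le' : ∀ x y, toFun (x * y) ≤ toFun x * toFun y
  star_mul_self' : ∀ x, toFun (star x * x) = toFun x ^ 2

namespace CStarSeminorm

variable {A : Type*} [Ring A] [StarRing A] [Algebra ℂ A]

instance : Inhabited (CStarSeminorm A) :=
  ⟨{ (0 : Seminorm ℂ A) with
      mul_le' := fun x y => by change (0 : ℝ) ≤ 0 * 0; simp
      star_mul_self' := fun x => by change (0 : ℝ) = 0 ^ 2; simp }⟩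

theorem one_le (p : CStarSeminorm A) : p.toSeminorm 1 ≤ 1 := by
  have h : p.toSeminorm (star 1 * 1) = p.toSeminorm 1 ^ 2 := p.star_mul_self' 1
  rw [star_one, mul_one] at h
  nlinarith [apply_nonneg p.toSeminorm 1]

theorem unitary_le (p : CStarSeminorm A) {u : A} (hu : star u * u = 1) : p.toSeminorm u ≤ 1 := by
  have h : p.toSeminorm (star u * u) = p.toSeminorm u ^ 2 := p.star_mul_self' u
  rw [hu] at h
  have := p.one_le
  nlinarith [apply_nonneg p.toSeminorm u]

theorem le_star (p : CStarSeminorm A) (x : A) : p.toSeminorm x ≤ p.toSeminorm (star x) := by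
  have h : p.toSeminorm (star x * x) = p.toSeminorm x ^ 2 := p.star_mul_self' x
  have h' : p.toSeminorm (star x * x) ≤ p.toSeminorm (star x) * p.toSeminorm x :=
    p.mul_le' (star x) x
  by_contra hlt
  push Not at hlt
  nlinarith [apply_nonneg p.toSeminorm (star x)]

theorem star_eq (p : CStarSeminorm A) (x : A) : p.toSeminorm (star x) = p.toSeminorm x :=
  le_antisymm (by simpa using p.le_star (star x)) (p.le_star x)

end CStarSeminorm

namespace GroupAlg

variable {G : Type*} [Group G]

theorem bdd (x : GroupAlg G) :
    BddAbove (Set.range fun p : CStarSeminorm (GroupAlg G) => p.toSeminorm x) := by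
  induction x using ind with
  | zero => exact ⟨0, by rintro _ ⟨p, rfl⟩; simp⟩
  | add x y hx hy =>
    obtain ⟨a, ha⟩ := hx
    obtain ⟨b, hb⟩ := hy
    refine ⟨a + b, ?_⟩
    rintro _ ⟨p, rfl⟩
    exact (map_add_le_add _ _ _).trans (add_le_add (ha ⟨p, rfl⟩) (hb ⟨p, rfl⟩))
  | single g a =>
    refine ⟨‖a‖, ?_⟩
    rintro _ ⟨p, rfl⟩
    have h1 : single g a = a • single g 1 := by rw [smul_single, mul_one]
    have h2 : star (single g 1) * single g 1 = (1 : GroupAlg G) := by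
      rw [star_single, single_mul_single, one_def]; simp
    have h3 := p.unitary_le h2
    change p.toSeminorm (single g a) ≤ ‖a‖
    rw [h1, map_smul_eq_mul]
    nlinarith [norm_nonneg a]

/-- The largest C*-seminorm on the group algebra. -/
def maxNorm (x : GroupAlg G) : ℝ := ⨆ p : CStarSeminorm (GroupAlg G), p.toSeminorm x

theorem le_maxNorm (p : CStarSeminorm (GroupAlg G)) (x : GroupAlg G) :
    p.toSeminorm x ≤ maxNorm x := le_ciSup (bdd x) p

theorem maxNorm_nonneg (x : GroupAlg G) : 0 ≤ maxNorm x :=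
  (apply_nonneg _ x).trans (le_maxNorm default x)

theorem maxNorm_mul_le (x y : GroupAlg G) : maxNorm (x * y) ≤ maxNorm x * maxNorm y :=
  ciSup_le fun p => (p.mul_le' x y).trans
    (mul_le_mul (le_maxNorm p x) (le_maxNorm p y) (apply_nonneg p.toSeminorm y)
      (maxNorm_nonneg x))

theorem maxNorm_star (x : GroupAlg G) : maxNorm (star x) = maxNorm x := by
  unfold maxNorm
  exact iSup_congr fun p => p.star_eq x

theorem maxNorm_sq_le (x : GroupAlg G) : maxNorm x * maxNorm x ≤ maxNorm (star x * x) := by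
  rw [← sq]
  refine (Real.le_sqrt (maxNorm_nonneg _) (maxNorm_nonneg _)).1
    (ciSup_le fun p => Real.le_sqrt_of_sq_le ?_)
  exact (p.star_mul_self' x).symm.le.trans (le_maxNorm p (star x * x))

theorem maxNorm_smul_le (c : ℂ) (x : GroupAlg G) : maxNorm (c • x) ≤ ‖c‖ * maxNorm x :=
  ciSup_le fun p => by
    rw [map_smul_eq_mul]
    exact mul_le_mul_of_nonneg_left (le_maxNorm p x) (norm_nonneg c)

instance : SeminormedRing (GroupAlg G) :=
  RingSeminorm.toSeminormedRing
    { toFun := maxNorm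
      map_zero' := by simp [maxNorm]
      add_le' := fun x y => ciSup_le fun p => (map_add_le_add _ _ _).trans
        (add_le_add (le_maxNorm p x) (le_maxNorm p y))
      neg' := fun x => by simp [maxNorm]
      mul_le' := maxNorm_mul_le }

theorem norm_def (x : GroupAlg G) : ‖x‖ = maxNorm x := rfl

instance : NormedAlgebra ℂ (GroupAlg G) where
  norm_smul_le := maxNorm_smul_le

instance : NormedStarGroup (GroupAlg G) where
  norm_star_le x := (maxNorm_star x).le

end GroupAlg

/-- The full group C*-algebra `C*(G)` of a discrete group `G`: the (Hausdorff) completion of the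
group algebra `ℂ[G]` with respect to its largest C*-seminorm. -/
def GroupCStar (G : Type*) [Group G] : Type _ := Completion (GroupAlg G)

namespace GroupCStar

variable {G : Type*} [Group G]

instance : NormedRing (GroupCStar G) := inferInstanceAs (NormedRing (Completion (GroupAlg G)))

instance : CompleteSpace (GroupCStar G) :=
  inferInstanceAs (CompleteSpace (Completion (GroupAlg G)))

instance : Algebra ℂ (GroupCStar G) := inferInstanceAs (Algebra ℂ (Completion (GroupAlg G)))

/-- The canonical map from the group algebra to `C*(G)`. -/
def mk : GroupAlg G →ₐ[ℂ] GroupCStar G :=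
  { (Completion.coeRingHom : GroupAlg G →+* Completion (GroupAlg G)) with
    commutes' := fun _ => rfl }

theorem norm_mk (x : GroupAlg G) : ‖mk x‖ = ‖x‖ := Completion.norm_coe x

theorem continuous_mk : Continuous (mk : GroupAlg G → GroupCStar G) :=
  Completion.continuous_coe _

theorem ind {P : GroupCStar G → Prop} (x : GroupCStar G) (hc : IsClosed {x | P x})
    (h : ∀ a, P (mk a)) : P x := Completion.induction_on x hc h

instance : NormedAlgebra ℂ (GroupCStar G) where
  norm_smul_le c x := by
    induction x using ind with
    | hc =>
      have : Continuous fun x : GroupCStar G => c • x := by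
        simp only [Algebra.smul_def]; fun_prop
      exact isClosed_le this.norm (by fun_prop)
    | h a =>
      rw [← map_smul, norm_mk, norm_mk]
      exact norm_smul_le c a

/-- The continuous extension of the involution of the group algebra to `C*(G)`. -/
def starMap : GroupCStar G → GroupCStar G := Completion.map (star : GroupAlg G → GroupAlg G)

theorem starMap_mk (x : GroupAlg G) : starMap (mk x) = mk (star x) :=
  Completion.map_coe star_isometry.uniformContinuous x

@[fun_prop]
theorem continuous_starMap : Continuous (starMap : GroupCStar G → GroupCStar G) :=
  Completion.continuous_map

instance : StarRing (GroupCStar G) where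
  star := starMap
  star_involutive x := by
    induction x using ind with
    | hc => exact isClosed_eq (by fun_prop) (by fun_prop)
    | h a =>
      rw [starMap_mk, starMap_mk, star_star]
  star_add x y := by
    change starMap (x + y) = starMap x + starMap y
    induction x using ind with
    | hc => exact isClosed_eq (by fun_prop) (by fun_prop)
    | h a =>
      induction y using ind with
      | hc => exact isClosed_eq (by fun_prop) (by fun_prop)
      | h b =>
        rw [← map_add, starMap_mk, starMap_mk, starMap_mk, star_add, map_add]
  star_mul x y := by
    change starMap (x * y) = starMap y * starMap x
    induction x using ind with
    | hc => exact isClosed_eq (by fun_prop) (by fun_prop)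
    | h a =>
      induction y using ind with
      | hc => exact isClosed_eq (by fun_prop) (by fun_prop)
      | h b =>
        rw [← map_mul, starMap_mk, starMap_mk, starMap_mk, star_mul, map_mul]

theorem star_mk (x : GroupAlg G) : star (mk x) = mk (star x) := starMap_mk x

theorem continuous_star' : Continuous (star : GroupCStar G → GroupCStar G) :=
  continuous_starMap

instance : CStarRing (GroupCStar G) where
  norm_mul_self_le x := by
    have := continuous_star' (G := G)
    induction x using ind with
    | hc => exact isClosed_le (by fun_prop) (by fun_prop)
    | h a =>
      rw [star_mk, ← map_mul, norm_mk, norm_mk]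
      exact GroupAlg.maxNorm_sq_le a

instance : StarModule ℂ (GroupCStar G) where
  star_smul c x := by
    have h1 : Continuous fun x : GroupCStar G => star (c • x) :=
      continuous_star'.comp (continuous_const_smul c)
    have h2 : Continuous fun x : GroupCStar G => star c • star x :=
      continuous_star'.const_smul (star c)
    induction x using ind with
    | hc => exact isClosed_eq h1 h2
    | h a => rw [← map_smul, star_mk, star_mk, star_smul, map_smul]

instance : CStarAlgebra (GroupCStar G) where

/-- The canonical unitary of `C*(G)` that corresponds to a group element. -/
def of : G →* GroupCStar G where
  toFun g := mk (GroupAlg.single g 1)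
  map_one' := map_one mk
  map_mul' g h := by rw [← map_mul, GroupAlg.single_mul_single, one_mul]

theorem star_of (g : G) : star (of g) = of g⁻¹ := by
  change star (mk (GroupAlg.single g 1)) = mk (GroupAlg.single g⁻¹ 1)
  rw [star_mk, GroupAlg.star_single, star_one]

/-- The operator system in `C*(G)` spanned by a set of group elements that contains the unit and
is closed under inverses. -/
def spanOpSystem (S : Set G) (h1 : (1 : G) ∈ S) (hinv : ∀ g ∈ S, g⁻¹ ∈ S) :
    OpSystem (GroupCStar G) where
  toSubmodule := Submodule.span ℂ (of '' S)
  one_mem' := Submodule.subset_span ⟨1, h1, map_one of⟩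
  star_mem' a ha := by
    change a ∈ Submodule.span ℂ (of '' S) at ha
    change star a ∈ Submodule.span ℂ (of '' S)
    induction ha using Submodule.span_induction with
    | mem x hx =>
      obtain ⟨g, hg, rfl⟩ := hx
      rw [star_of]
      exact Submodule.subset_span ⟨g⁻¹, hinv g hg, rfl⟩
    | zero => simp
    | add x y _ _ hx hy => rw [star_add]; exact add_mem hx hy
    | smul c x _ hx => rw [star_smul]; exact Submodule.smul_mem _ _ hx

end GroupCStar

/-! ### Noncommutative cubes and prisms -/

/-- The cyclic group of order `k`, written multiplicatively. -/
abbrev Cyc (k : ℕ) : Type := Multiplicative (ZMod k)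

/-- The canonical generator of the cyclic group. -/
def Cyc.gen (k : ℕ) : Cyc k := Multiplicative.ofAdd 1

theorem Cyc.gen_pow (k : ℕ) : Cyc.gen k ^ k = 1 := by
  rw [Cyc.gen, ← ofAdd_nsmul]
  simp

/-- The free product of `d` copies of `ℤ/2`. -/
abbrev CubeGroup (d : ℕ) : Type := Monoid.CoprodI fun _ : Fin d => Cyc 2

/-- The generator of the `j`-th copy of `ℤ/2`. -/
def CubeGroup.u {d : ℕ} (j : Fin d) : CubeGroup d :=
  Monoid.CoprodI.of (M := fun _ : Fin d => Cyc 2) (i := j) (Cyc.gen 2)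

theorem CubeGroup.u_inv {d : ℕ} (j : Fin d) : (CubeGroup.u j)⁻¹ = CubeGroup.u j := by
  rw [inv_eq_iff_mul_eq_one, CubeGroup.u, ← map_mul, ← sq, Cyc.gen_pow, map_one]

/-- The noncommutative `d`-cube `NC(d) = Span{1, u_1, …, u_d} ⊆ C*(ℤ/2 * ⋯ * ℤ/2)`. -/
def NC (d : ℕ) : OpSystem (GroupCStar (CubeGroup d)) :=
  GroupCStar.spanOpSystem (insert 1 (Set.range CubeGroup.u)) (Set.mem_insert _ _) (by
    rintro _ (rfl | ⟨j, rfl⟩)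
    · simp
    · exact Or.inr ⟨j, (CubeGroup.u_inv j).symm⟩)

/-- The free product `ℤ/k * ℤ/2`. -/
abbrev PrismGroup (k : ℕ) : Type := Monoid.Coprod (Cyc k) (Cyc 2)

/-- The generator of `ℤ/k` in `ℤ/k * ℤ/2`. -/
def PrismGroup.w (k : ℕ) : PrismGroup k := Monoid.Coprod.inl (Cyc.gen k)

/-- The generator of `ℤ/2` in `ℤ/k * ℤ/2`. -/
def PrismGroup.v (k : ℕ) : PrismGroup k := Monoid.Coprod.inr (Cyc.gen 2)

theorem PrismGroup.w_pow (k : ℕ) : PrismGroup.w k ^ k = 1 := by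
  rw [PrismGroup.w, ← map_pow, Cyc.gen_pow, map_one]

theorem PrismGroup.v_inv (k : ℕ) : (PrismGroup.v k)⁻¹ = PrismGroup.v k := by
  rw [inv_eq_iff_mul_eq_one, PrismGroup.v, ← map_mul, ← sq, Cyc.gen_pow, map_one]

/-- The noncommutative `k`-prism
`NCP(k) = Span{1, w, w², …, w^(k-1), v} ⊆ C*(ℤ/k * ℤ/2)`, for `k ≥ 1`. -/
def NCP (k : ℕ) [NeZero k] : OpSystem (GroupCStar (PrismGroup k)) :=
  GroupCStar.spanOpSystem
    (insert (PrismGroup.v k) (Set.range fun j : Fin k => PrismGroup.w k ^ (j : ℕ)))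
    (Or.inr ⟨0, by simp⟩) (by
    rintro _ (rfl | ⟨j, rfl⟩)
    · exact Or.inl (PrismGroup.v_inv k)
    · refine Or.inr ⟨⟨(k - j) % k, Nat.mod_lt _ (NeZero.pos k)⟩, ?_⟩
      have hk : PrismGroup.w k ^ ((k - (j : ℕ)) % k) = PrismGroup.w k ^ (k - (j : ℕ)) := by
        conv_rhs => rw [← Nat.mod_add_div (k - (j : ℕ)) k, pow_add, pow_mul, PrismGroup.w_pow,
          one_pow, mul_one]
      rw [eq_inv_iff_mul_eq_one]
      change PrismGroup.w k ^ ((k - (j : ℕ)) % k) * PrismGroup.w k ^ (j : ℕ) = 1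
      rw [hk, ← pow_add, Nat.sub_add_cancel j.2.le, PrismGroup.w_pow])

/-! ### Control of the codomain of ucp extensions -/

/-- `R` has a C*-envelope, and for every C*-envelope `ι : R → B` of `R` and every ucp map
`φ : R → B(H)` on a complex Hilbert space there is a ucp map `Φ` from `B` to the von Neumann
algebra `φ(R)''` that extends `φ`. -/
def HasControlledExtensions.{a, b, c} {A : Type a} [CStarAlgebra A] (R : OpSystem A) : Prop :=
  (∃ (B : Type a) (_ : CStarAlgebra B) (ι : R.Elt →ₗ[ℂ] B), R.IsCStarEnvelope ι) ∧
  ∀ (B : Type b) [CStarAlgebra B] (ι : R.Elt →ₗ[ℂ] B), R.IsCStarEnvelope ι →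
  ∀ (H : Type c) [NormedAddCommGroup H] [InnerProductSpace ℂ H] [CompleteSpace H]
    (φ : R.Elt →ₗ[ℂ] (H →L[ℂ] H)), R.IsUCP φ →
    ∃ Φ : B →ₗ[ℂ] (H →L[ℂ] H), IsUCPMap Φ ∧
      (∀ b, Φ b ∈ Set.centralizer (Set.centralizer (Set.range φ))) ∧
      ∀ x, Φ (ι x) = φ x

end NCCube

end

/-!
The proof has two independent parts, which meet in `hasControlledExtensions_of_extension`.

*The C*-envelope is `C*(G)`.* Let `R` be an operator system in `A` spanned by unitaries, and let
`κ : R → C` be a C*-cover. If `f` is a positive functional on `A`, then `M ↦ f (∑ x* M_{xy} y)` is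
positive on the finitely supported matrices over `R` with indices in `A`. Since `κ` is a complete
order embedding, this functional carries over to the matrices over `κ(R)`, and by the extension
theorem of M. Riesz it extends to a positive functional on the matrices over `C`
(`exists_matrix_functional`). It gives a positive bilinear form on the span of the vectors `c ⊗ y`, with
`c ∈ C` and `y ∈ A`. For a unitary `u` in `R` the element `κ(u)` is a contraction, which forces
`κ(u) ⊗ y - 1 ⊗ u y` to have length zero. So `c ⊗ 1` and `1 ⊗ a` agree whenever `(a, c)` lies in the
algebra generated by the graph of `κ`, and `f (a* a) ≤ ‖c‖² f 1` follows
(`functional_le_of_mem_adjoin`). As `f` is arbitrary, `‖a‖ ≤ ‖c‖`, so the closure of that algebra is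
the graph of a *-homomorphism on `C` (`exists_starAlgHom_of_isCStarCover`). In particular every
C*-envelope of `R` maps onto `C*(G)` over `R`, and it remains to extend maps to `C*(G)`.

*Extension to `C*(G)` inside the codomain.* A unital completely positive map `φ : R → N` into any
unital C*-algebra `N` extends to a unital completely positive map `C*(G) → N`: the unitaries of a
dilation can be chosen in matrices over `N`. For the cube, `T_j = φ(u_j)` is a self-adjoint
contraction, hence the corner of a symmetry in `M₂(N)`; these symmetries define a representation of
`C*(G)` in `M₂(N)` by the universal property, and its corner extends `φ` (`NC_exists_extension`).
For the prism, the spectral projections of `w` have images `P_i ≥ 0` of sum `1`, so that the column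
`V = (√P_i)` is an isometry over `N`. It compresses the diagonal representation of `ℤ/k` to `φ`, and
the self-adjoint contraction `V T V*` to `T = φ(v)`; and `V T V*` is again the corner of a
symmetry (`NCP_exists_extension`). The theorem is the case `N = φ(R)''`, where positivity of matrices over
`N` may be tested in `B(H)` (`MatPos.of_map`).
-/

noncomputable section

namespace NCCube

open UniformSpace

/-! ### The universal property of the full group C*-algebra -/

section Universal

variable {G : Type*} [Group G] {D : Type*} [CStarAlgebra D]

/-- The linear extension of a unitary representation to the group algebra. -/
def GroupAlg.liftAlg (ρ : G →* unitary D) : GroupAlg G →ₐ[ℂ] D :=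
  MonoidAlgebra.lift ℂ D G ((unitary D).subtype.comp ρ)

theorem GroupAlg.liftAlg_single (ρ : G →* unitary D) (g : G) (a : ℂ) :
    liftAlg ρ (single g a) = a • (ρ g : D) :=
  MonoidAlgebra.lift_single _ _ _

theorem GroupAlg.liftAlg_star (ρ : G →* unitary D) (x : GroupAlg G) :
    liftAlg ρ (star x) = star (liftAlg ρ x) := by
  induction x using GroupAlg.ind with
  | zero => simp
  | add x y hx hy => simp [hx, hy]
  | single g a =>
    rw [GroupAlg.star_single, liftAlg_single, liftAlg_single, star_smul, map_inv]
    rfl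

/-- The C*-seminorm on the group algebra that a unitary representation defines. -/
def GroupAlg.liftSeminorm (ρ : G →* unitary D) : CStarSeminorm (GroupAlg G) where
  toSeminorm := (normSeminorm ℂ D).comp (liftAlg ρ).toLinearMap
  mul_le' x y := by
    change ‖liftAlg ρ (x * y)‖ ≤ ‖liftAlg ρ x‖ * ‖liftAlg ρ y‖
    rw [map_mul]
    exact norm_mul_le _ _
  star_mul_self' x := by
    change ‖liftAlg ρ (star x * x)‖ = ‖liftAlg ρ x‖ ^ 2
    rw [map_mul, liftAlg_star, CStarRing.norm_star_mul_self, sq]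

theorem GroupAlg.norm_liftAlg_le (ρ : G →* unitary D) (x : GroupAlg G) :
    ‖liftAlg ρ x‖ ≤ ‖x‖ :=
  GroupAlg.le_maxNorm (liftSeminorm ρ) x

theorem GroupAlg.continuous_liftAlg (ρ : G →* unitary D) : Continuous (liftAlg ρ) :=
  AddMonoidHomClass.continuous_of_bound (liftAlg ρ) 1
    fun x => by simpa using norm_liftAlg_le ρ x

/-- The *-homomorphism on `C*(G)` that a unitary representation of `G` in a C*-algebra induces. -/
def GroupCStar.lift (ρ : G →* unitary D) : GroupCStar G →⋆ₐ[ℂ] D :=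
  let f : GroupCStar G →+* D :=
    Completion.extensionHom (GroupAlg.liftAlg ρ : GroupAlg G →+* D) (GroupAlg.continuous_liftAlg ρ)
  have hf : ∀ x, f (mk x) = GroupAlg.liftAlg ρ x := fun x =>
    Completion.extensionHom_coe (GroupAlg.liftAlg ρ : GroupAlg G →+* D)
      (GroupAlg.continuous_liftAlg ρ) x
  have hc : Continuous f := Completion.continuous_extension
  { f with
    commutes' := fun c => by
      change f (algebraMap ℂ (GroupCStar G) c) = _
      rw [← mk.commutes c, hf, AlgHom.commutes]
    map_star' := fun x => by
      change f (star x) = star (f x)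
      have := continuous_star' (G := G)
      induction x using GroupCStar.ind with
      | hc => exact isClosed_eq (by fun_prop) (by fun_prop)
      | h a => rw [star_mk, hf, hf, GroupAlg.liftAlg_star] }

theorem GroupCStar.lift_of (ρ : G →* unitary D) (g : G) : lift ρ (of g) = ρ g := by
  have h : lift ρ (of g) = GroupAlg.liftAlg ρ (GroupAlg.single g 1) :=
    Completion.extensionHom_coe (GroupAlg.liftAlg ρ : GroupAlg G →+* D)
      (GroupAlg.continuous_liftAlg ρ) _
  rw [h, GroupAlg.liftAlg_single, one_smul]

theorem GroupCStar.of_mem_unitary (g : G) : of g ∈ unitary (GroupCStar G) := by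
  rw [Unitary.mem_iff, star_of, ← map_mul, ← map_mul]
  simp

theorem GroupCStar.topologicalClosure_eq_top (B : StarSubalgebra ℂ (GroupCStar G))
    (h : ∀ g : G, of g ∈ B) : B.topologicalClosure = ⊤ := by
  refine (StarSubalgebra.eq_top_iff).2 fun x => ?_
  induction x using GroupCStar.ind with
  | hc => exact B.isClosed_topologicalClosure
  | h a =>
    refine B.le_topologicalClosure ?_
    induction a using GroupAlg.ind with
    | zero => simp
    | add x y hx hy => rw [map_add]; exact add_mem hx hy
    | single g a =>
      have : GroupAlg.single g a = a • GroupAlg.single g 1 := by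
        rw [GroupAlg.smul_single, mul_one]
      rw [this, map_smul]
      exact B.smul_mem (h g) a

end Universal

/-! ### Positive matrices -/

section MatPos

variable {A B C : Type*} [CStarAlgebra A] [CStarAlgebra B] [CStarAlgebra C]

theorem MatPos.add {n : ℕ} {M N : Matrix (Fin n) (Fin n) A} (hM : MatPos M) (hN : MatPos N) :
    MatPos (M + N) := by
  let _ := CStarAlgebra.spectralOrder A
  have := CStarAlgebra.spectralOrderedRing A
  rw [matPos_iff_nonneg] at *
  exact add_nonneg hM hN

theorem MatPos.zero (n : ℕ) : MatPos (0 : Matrix (Fin n) (Fin n) A) := ⟨0, by simp⟩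

theorem MatPos.sum {ι : Type*} {n : ℕ} (s : Finset ι) {M : ι → Matrix (Fin n) (Fin n) A}
    (h : ∀ i ∈ s, MatPos (M i)) : MatPos (∑ i ∈ s, M i) :=
  Finset.sum_induction M MatPos (fun _ _ => MatPos.add) (MatPos.zero n) h

theorem matPos_row {n : ℕ} (v : Fin n → A) :
    MatPos (Matrix.of fun i j => star (v i) * v j) := by
  cases n with
  | zero => exact ⟨0, Subsingleton.elim _ _⟩
  | succ n =>
    refine ⟨Matrix.of fun i j => if i = 0 then v j else 0, ?_⟩
    ext i j
    simp [Matrix.mul_apply]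

/-- Gram matrices are positive, also those of rectangular matrices. -/
theorem matPos_gram {ι : Type*} [Fintype ι] {n : ℕ} (Y : Matrix ι (Fin n) A) :
    MatPos (Y.conjTranspose * Y) := by
  have : Y.conjTranspose * Y = ∑ l, Matrix.of fun i j => star (Y l i) * Y l j := by
    ext i j
    simp [Matrix.mul_apply, Matrix.sum_apply]
  rw [this]
  exact MatPos.sum _ fun l _ => matPos_row (Y l)

/-- The compression of a positive matrix by a column is positive. -/
theorem MatPos.compress [PartialOrder A] [StarOrderedRing A] {n : ℕ}
    {M : Matrix (Fin n) (Fin n) A} (hM : MatPos M) (v : Fin n → A) :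
    0 ≤ ∑ i, ∑ j, star (v i) * M i j * v j := by
  obtain ⟨N, rfl⟩ := hM
  have : ∑ i, ∑ j, star (v i) * (N.conjTranspose * N) i j * v j
      = ∑ k, star (∑ i, N k i * v i) * ∑ i, N k i * v i := by
    simp only [Matrix.mul_apply, Matrix.conjTranspose_apply, star_sum, star_mul, Finset.sum_mul,
      Finset.mul_sum]
    rw [Finset.sum_comm]
    conv_lhs => enter [2, y]; rw [Finset.sum_comm]
    rw [Finset.sum_comm]
    refine Finset.sum_congr rfl fun k _ => ?_
    simp only [mul_assoc]
  rw [this]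
  exact Finset.sum_nonneg fun k _ => star_mul_self_nonneg _

theorem MatPos.map_starAlgHom {n : ℕ} {M : Matrix (Fin n) (Fin n) A} (hM : MatPos M)
    (f : A →⋆ₐ[ℂ] B) : MatPos (M.map f) := by
  obtain ⟨N, rfl⟩ := hM
  refine ⟨N.map f, ?_⟩
  ext i j
  simp [Matrix.mul_apply, map_star]

theorem nonneg_of_map_nonneg [PartialOrder A] [StarOrderedRing A] [PartialOrder B]
    [StarOrderedRing B] (f : A →⋆ₐ[ℂ] B) (hf : Function.Injective f) {a : A} (h : 0 ≤ f a) :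
    0 ≤ a := by
  have ha : IsSelfAdjoint a := hf <| by rw [map_star]; exact h.isSelfAdjoint
  rw [StarOrderedRing.nonneg_iff_spectrum_nonneg (R := ℝ) a ha]
  rw [StarOrderedRing.nonneg_iff_spectrum_nonneg (R := ℝ) _ h.isSelfAdjoint,
    ha.map_spectrum_real f hf] at h
  exact h

/-- The *-homomorphism on matrices that a *-homomorphism induces entrywise. -/
def mapMatrix (n : ℕ) (f : A →⋆ₐ[ℂ] B) :
    CStarMatrix (Fin n) (Fin n) A →⋆ₐ[ℂ] CStarMatrix (Fin n) (Fin n) B where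
  toFun M := M.map f
  map_one' := by ext i j; simp [CStarMatrix.one_apply, apply_ite f]
  map_zero' := by ext i j; simp
  map_mul' M N := by ext i j; simp [CStarMatrix.mul_apply]
  map_add' M N := by ext i j; simp
  commutes' c := by ext i j; simp [CStarMatrix.algebraMap_apply, apply_ite f, AlgHomClass.commutes]
  map_star' M := by ext i j; simp [CStarMatrix.star_apply, map_star]

/-- Positivity of matrices does not depend on the C*-algebra in which it is tested. -/
theorem MatPos.of_map {n : ℕ} {M : Matrix (Fin n) (Fin n) A}
    (f : A →⋆ₐ[ℂ] B) (hf : Function.Injective f) (h : MatPos (M.map f)) : MatPos M := by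
  let _ := CStarAlgebra.spectralOrder A
  have := CStarAlgebra.spectralOrderedRing A
  let _ := CStarAlgebra.spectralOrder B
  have := CStarAlgebra.spectralOrderedRing B
  rw [matPos_iff_nonneg] at *
  exact nonneg_of_map_nonneg (mapMatrix n f) (CStarMatrix.map_injective hf) h

end MatPos

/-! ### Unital completely positive maps -/

section UCP

variable {A B C : Type*} [CStarAlgebra A] [CStarAlgebra B] [CStarAlgebra C]

theorem isUCPMap_starAlgHom (f : A →⋆ₐ[ℂ] B) : IsUCPMap (f : A →ₗ[ℂ] B) :=
  ⟨map_one f, fun _ _ h => h.map_starAlgHom f⟩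

theorem IsUCPMap.comp {Ψ : B →ₗ[ℂ] C} {Φ : A →ₗ[ℂ] B} (hΨ : IsUCPMap Ψ) (hΦ : IsUCPMap Φ) :
    IsUCPMap (Ψ ∘ₗ Φ) :=
  ⟨by simp [hΦ.map_one, hΨ.map_one], fun n M hM => hΨ.map_pos n _ (hΦ.map_pos n M hM)⟩

/-- The compression `X ↦ V* X V` of matrices over `A` by a column `V`. -/
def compression {ι : Type*} [Fintype ι] (V : ι → A) : CStarMatrix ι ι A →ₗ[ℂ] A where
  toFun X := ∑ i, ∑ j, star (V i) * X i j * V j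
  map_add' X Y := by simp [mul_add, add_mul, Finset.sum_add_distrib]
  map_smul' c X := by simp [Finset.smul_sum]

theorem isUCPMap_compression [PartialOrder A] [StarOrderedRing A] {ι : Type*} [Fintype ι]
    [DecidableEq ι] (V : ι → A) (hV : ∑ i, star (V i) * V i = 1) :
    IsUCPMap (compression V) := by
  refine ⟨?_, ?_⟩
  · rw [← hV]
    simp [compression, CStarMatrix.one_apply]
  · rintro n _ ⟨N, rfl⟩
    let Y : Matrix (Fin n × ι) (Fin n) A := Matrix.of fun p j => ∑ l, (N p.1 j) p.2 l * V l
    convert matPos_gram Y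
    ext i j
    simp only [compression, Matrix.map_apply, Matrix.mul_apply, Matrix.conjTranspose_apply, Y,
      Matrix.of_apply, Fintype.sum_prod_type, LinearMap.coe_mk, AddHom.coe_mk]
    have h1 : ∀ a b : ι, (∑ k, star (N k i) * N k j : CStarMatrix ι ι A) a b
        = ∑ k, ∑ c, star (N k i c a) * N k j c b := by
      intro a b
      have h2 : ∀ s : Finset (Fin n), (∑ k ∈ s, star (N k i) * N k j : CStarMatrix ι ι A) a b
        = ∑ k ∈ s, (star (N k i) * N k j) a b := by
        intro s
        induction s using Finset.cons_induction with
        | empty => simp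
        | cons x s hx ih => rw [Finset.sum_cons, Finset.sum_cons, CStarMatrix.add_apply, ih]
      rw [h2]
      simp [CStarMatrix.mul_apply, CStarMatrix.star_apply]
    simp only [h1, Finset.mul_sum, Finset.sum_mul, star_sum, star_mul]
    rw [Finset.sum_congr rfl fun a _ => Finset.sum_comm]
    rw [Finset.sum_comm]
    refine Finset.sum_congr rfl fun k _ => ?_
    rw [Finset.sum_congr rfl fun a _ => Finset.sum_comm]
    rw [Finset.sum_comm]
    refine Finset.sum_congr rfl fun c _ => ?_
    rw [Finset.sum_comm]
    simp only [mul_assoc]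

variable {R : OpSystem A} {φ : R.Elt →ₗ[ℂ] B}

theorem OpSystem.IsCStarCover.isUCP (h : R.IsCStarCover φ) : R.IsUCP φ :=
  ⟨h.map_unit, fun n M hM => (h.map_pos_iff n M).2 hM⟩

/-- The involution that an operator system inherits. -/
instance : Star R.Elt := ⟨fun x => ⟨star (x : A), R.star_mem' x x.2⟩⟩

theorem OpSystem.coe_star (x : R.Elt) : ((star x : R.Elt) : A) = star (x : A) := rfl

theorem OpSystem.IsUCP.map_nonneg [PartialOrder A] [StarOrderedRing A] [PartialOrder B]
    [StarOrderedRing B] (h : R.IsUCP φ) {x : R.Elt} (hx : 0 ≤ (x : A)) : 0 ≤ φ x := by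
  obtain ⟨b, hb⟩ := CStarAlgebra.nonneg_iff_eq_star_mul_self.1 hx
  have h1 : R.Pos (Matrix.of fun _ _ : Fin 1 => x) :=
    ⟨Matrix.of fun _ _ => b, by ext i j; simp [Matrix.mul_apply, hb]⟩
  simpa using (h.map_pos 1 _ h1).compress fun _ => 1

/-- Unital completely positive maps preserve the involution: a self-adjoint `x` is the difference
of the positive elements `x + ‖x‖` and `‖x‖`. -/
theorem OpSystem.IsUCP.map_star (h : R.IsUCP φ) (x : R.Elt) : φ (star x) = star (φ x) := by
  let _ := CStarAlgebra.spectralOrder A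
  have := CStarAlgebra.spectralOrderedRing A
  let _ := CStarAlgebra.spectralOrder B
  have := CStarAlgebra.spectralOrderedRing B
  have key : ∀ y : R.Elt, IsSelfAdjoint (y : A) → IsSelfAdjoint (φ y) := by
    intro y hy
    have h1 : 0 ≤ ((y + ((‖(y : A)‖ : ℝ) : ℂ) • R.unit : R.Elt) : A) := by
      have := hy.neg_algebraMap_norm_le_self
      rw [neg_le_iff_add_nonneg, Algebra.algebraMap_eq_smul_one] at this
      simpa [OpSystem.unit] using this
    have h2 := (h.map_nonneg h1).isSelfAdjoint
    rw [map_add, map_smul, h.map_unit] at h2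
    have h3 : IsSelfAdjoint (((‖(y : A)‖ : ℝ) : ℂ) • (1 : B)) := by
      simp [IsSelfAdjoint, star_smul]
    simpa using h2.sub h3
  have h1 := key (x + star x) (by simp [IsSelfAdjoint, OpSystem.coe_star, add_comm])
  have h2 := key (Complex.I • (x - star x)) (by
    simp [IsSelfAdjoint, OpSystem.coe_star, star_smul, smul_sub, neg_add_eq_sub])
  simp only [IsSelfAdjoint, map_add, map_smul, map_sub, star_add, star_sub, star_smul,
    Complex.star_def, Complex.conj_I] at h1 h2
  have h3 : star (φ x) - star (φ (star x)) = -(φ x - φ (star x)) := by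
    have := congrArg (fun z => Complex.I • z) h2
    simpa [smul_smul] using this
  have h4 : (2 : ℂ) • φ (star x) = (2 : ℂ) • star (φ x) := by
    have e1 : (2 : ℂ) • φ (star x) = φ x + φ (star x) + -(φ x - φ (star x)) := by module
    have e2 : (2 : ℂ) • star (φ x)
        = star (φ x) + star (φ (star x)) + (star (φ x) - star (φ (star x))) := by module
    rw [e1, e2, h1, h3]
  exact smul_right_injective B (two_ne_zero (α := ℂ)) h4

/-- The image of an isometry `u` of an operator system under a unital completely positive map is a
contraction, because the matrix with rows `(1, u)` and `(u*, 1)` is positive. -/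
theorem OpSystem.IsUCP.star_mul_self_le_one [PartialOrder B] [StarOrderedRing B]
    (h : R.IsUCP φ) (u : R.Elt) (hu : star (u : A) * u = 1) : star (φ u) * φ u ≤ 1 := by
  have h1 : R.Pos !![R.unit, u; star u, R.unit] := by
    refine ⟨!![1, (u : A); 0, 0], ?_⟩
    ext i j
    fin_cases i <;> fin_cases j <;>
      simp [Matrix.mul_apply, hu, OpSystem.unit, OpSystem.coe_star]
  have h2 := (h.map_pos 2 _ h1).compress ![-φ u, 1]
  simp [Fin.sum_univ_two, h.map_unit, h.map_star] at h2
  exact h2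

end UCP

/-! ### Unitary dilations with entries in a given C*-algebra -/

section Dilation

variable {D : Type*} [CStarAlgebra D]

/-- The homomorphism from the cyclic group of order `k` that sends the generator to `g`. -/
def cycLift {H : Type*} [Group H] (k : ℕ) (g : H) (hg : g ^ k = 1) : Cyc k →* H :=
  AddMonoidHom.toMultiplicativeLeft <| ZMod.lift k
    ⟨zmultiplesHom (Additive H) (Additive.ofMul g), by
      rw [zmultiplesHom_apply, natCast_zsmul, ← ofMul_pow, hg, ofMul_one]⟩

theorem cycLift_gen {H : Type*} [Group H] (k : ℕ) (g : H) (hg : g ^ k = 1) :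
    cycLift k g hg (Cyc.gen k) = g := by
  have h := ZMod.lift_coe k ⟨zmultiplesHom (Additive H) (Additive.ofMul g), by
      rw [zmultiplesHom_apply, natCast_zsmul, ← ofMul_pow, hg, ofMul_one]⟩ 1
  simp only [Int.cast_one, zmultiplesHom_apply, one_zsmul] at h
  exact h

variable [PartialOrder D] [StarOrderedRing D]

/-- The Halmos dilation: a self-adjoint contraction `y` is the upper left corner of the symmetry
with rows `(y, √(1 - y²))` and `(√(1 - y²), -y)`. -/
theorem exists_symmetry_dilation {y : D} (hy : IsSelfAdjoint y) (hy1 : y * y ≤ 1) :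
    ∃ U : unitary (CStarMatrix (Fin 2) (Fin 2) D),
      U ^ 2 = 1 ∧ (U : CStarMatrix (Fin 2) (Fin 2) D) 0 0 = y := by
  set s := CFC.sqrt (1 - y * y) with hs
  have hs1 : s * s = 1 - y * y := CFC.sqrt_mul_sqrt_self _ (sub_nonneg.2 hy1)
  have hs2 : star s = s := (CFC.sqrt_nonneg _).isSelfAdjoint
  have hc : y * s = s * y := by
    have h1 : Commute (1 - y * y) y := (Commute.one_left y).sub_left (Commute.mul_left rfl rfl)
    exact (h1.cfcₙ_nnreal _).symm
  let U : CStarMatrix (Fin 2) (Fin 2) D := CStarMatrix.ofMatrix !![y, s; s, -y]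
  have hU : star U = U := by
    ext i j
    rw [CStarMatrix.star_apply]
    fin_cases i <;> fin_cases j <;> simp [U, hs2, hy.star_eq]
  have hUU : U * U = 1 := by
    ext i j
    rw [CStarMatrix.mul_apply, Fin.sum_univ_two, CStarMatrix.one_apply]
    fin_cases i <;> fin_cases j <;> simp [U, hs1, hc]
  have hmem : U ∈ unitary (CStarMatrix (Fin 2) (Fin 2) D) := by
    rw [Unitary.mem_iff, hU]
    exact ⟨hUU, hUU⟩
  exact ⟨⟨U, hmem⟩, Subtype.ext (by simpa [sq] using hUU), rfl⟩

/-- The embedding of `D` in the `2 × 2` matrices over `D` as `diag(x, x)`. -/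
def diagHom : D →⋆ₐ[ℂ] CStarMatrix (Fin 2) (Fin 2) D where
  toFun x := CStarMatrix.ofMatrix (Matrix.diagonal fun _ => x)
  map_one' := by ext i j; simp [CStarMatrix.one_apply, Matrix.one_apply]
  map_zero' := by ext i j; simp
  map_mul' x y := by
    ext i j; simp [CStarMatrix.mul_apply, Matrix.diagonal_apply]
  map_add' x y := by ext i j; fin_cases i <;> fin_cases j <;> simp
  commutes' c := by ext i j; simp [CStarMatrix.algebraMap_apply, Matrix.diagonal_apply]
  map_star' x := by
    ext i j; fin_cases i <;> fin_cases j <;> simp [CStarMatrix.star_apply]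

/-- The upper left corner of a `2 × 2` matrix, as the compression by the first unit vector. -/
def corner (D : Type*) [CStarAlgebra D] : CStarMatrix (Fin 2) (Fin 2) D →ₗ[ℂ] D :=
  compression (Pi.single 0 1)

omit [PartialOrder D] [StarOrderedRing D] in
theorem corner_apply (X : CStarMatrix (Fin 2) (Fin 2) D) : corner D X = X 0 0 := by
  simp [corner, compression, Fin.sum_univ_two]

theorem isUCPMap_corner : IsUCPMap (corner D) :=
  isUCPMap_compression _ (by simp [Fin.sum_univ_two])

end Dilation

section Agree

variable {G : Type*} [Group G]

/-- The element of an operator system spanned by group elements that a group element defines. -/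
def groupElt {S : Set G} {h1 : (1 : G) ∈ S} {hinv : ∀ g ∈ S, g⁻¹ ∈ S} (g : G) (hg : g ∈ S) :
    (GroupCStar.spanOpSystem S h1 hinv).Elt :=
  ⟨GroupCStar.of g, Submodule.subset_span ⟨g, hg, rfl⟩⟩

theorem eq_of_eq_groupElt {S : Set G} {h1 : (1 : G) ∈ S} {hinv : ∀ g ∈ S, g⁻¹ ∈ S}
    {N : Type*} [AddCommGroup N] [Module ℂ N]
    {φ ψ : (GroupCStar.spanOpSystem S h1 hinv).Elt →ₗ[ℂ] N}
    (h : ∀ (g : G) (hg : g ∈ S), φ (groupElt g hg) = ψ (groupElt g hg)) : φ = ψ := by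
  ext ⟨x, hx⟩
  change x ∈ Submodule.span ℂ (GroupCStar.of '' S) at hx
  induction hx using Submodule.span_induction with
  | mem x hx =>
    obtain ⟨g, hg, rfl⟩ := hx
    exact h g hg
  | zero => exact (map_zero φ).trans (map_zero ψ).symm
  | add x y hx' hy' hx hy =>
    exact (map_add φ ⟨x, hx'⟩ ⟨y, hy'⟩).trans
      ((congrArg₂ (· + ·) hx hy).trans (map_add ψ ⟨x, hx'⟩ ⟨y, hy'⟩).symm)
  | smul c x hx' hx =>
    exact (map_smul φ c ⟨x, hx'⟩).trans
      ((congrArg (c • ·) hx).trans (map_smul ψ c ⟨x, hx'⟩).symm)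

/-- Unital completely positive maps send involutions in the group to self-adjoint contractions. -/
theorem OpSystem.IsUCP.groupElt_involution {S : Set G} {h1 : (1 : G) ∈ S}
    {hinv : ∀ g ∈ S, g⁻¹ ∈ S} {N : Type*} [CStarAlgebra N] [PartialOrder N] [StarOrderedRing N]
    {φ : (GroupCStar.spanOpSystem S h1 hinv).Elt →ₗ[ℂ] N}
    (hφ : (GroupCStar.spanOpSystem S h1 hinv).IsUCP φ) {g : G} (hg : g ∈ S) (hg2 : g⁻¹ = g) :
    IsSelfAdjoint (φ (groupElt g hg)) ∧ φ (groupElt g hg) * φ (groupElt g hg) ≤ 1 := by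
  have h2 : star (groupElt g hg : (GroupCStar.spanOpSystem S h1 hinv).Elt) = groupElt g hg :=
    Subtype.ext (by rw [OpSystem.coe_star]; exact (GroupCStar.star_of g).trans (by rw [hg2]; rfl))
  have h3 : IsSelfAdjoint (φ (groupElt g hg)) := by
    rw [IsSelfAdjoint, ← hφ.map_star, h2]
  refine ⟨h3, ?_⟩
  have h4 := hφ.star_mul_self_le_one (groupElt g hg) (GroupCStar.of_mem_unitary g).1
  rwa [h3.star_eq] at h4

end Agree

/-! ### Extension of unital completely positive maps, without enlarging the codomain -/

section Extension

variable {N : Type*} [CStarAlgebra N]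

theorem NC_exists_extension (d : ℕ) (φ : (NC d).Elt →ₗ[ℂ] N) (hφ : (NC d).IsUCP φ) :
    ∃ Φ : GroupCStar (CubeGroup d) →ₗ[ℂ] N, IsUCPMap Φ ∧ ∀ x : (NC d).Elt, Φ x = φ x := by
  let _ := CStarAlgebra.spectralOrder N
  have := CStarAlgebra.spectralOrderedRing N
  have hu : ∀ j : Fin d, CubeGroup.u j ∈ insert (1 : CubeGroup d) (Set.range CubeGroup.u) :=
    fun j => Or.inr ⟨j, rfl⟩
  choose U hU2 hU using fun j =>
    exists_symmetry_dilation (hφ.groupElt_involution (hu j) (CubeGroup.u_inv j)).1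
      (hφ.groupElt_involution (hu j) (CubeGroup.u_inv j)).2
  let ρ : CubeGroup d →* unitary (CStarMatrix (Fin 2) (Fin 2) N) :=
    Monoid.CoprodI.lift fun j => cycLift 2 (U j) (hU2 j)
  let Φ : GroupCStar (CubeGroup d) →ₗ[ℂ] N :=
    corner N ∘ₗ (GroupCStar.lift ρ : GroupCStar (CubeGroup d) →ₗ[ℂ] _)
  refine ⟨Φ, isUCPMap_corner.comp (isUCPMap_starAlgHom _), ?_⟩
  have key : Φ ∘ₗ (NC d).toSubmodule.subtype = φ := by
    refine eq_of_eq_groupElt fun g hg => ?_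
    change corner N (GroupCStar.lift ρ (GroupCStar.of g)) = _
    rw [GroupCStar.lift_of, corner_apply]
    obtain rfl | ⟨j, rfl⟩ := hg
    · rw [map_one]
      exact hφ.map_unit.symm
    · have : ρ (CubeGroup.u j) = U j := by
        rw [CubeGroup.u, Monoid.CoprodI.lift_of, cycLift_gen]
      rw [this]
      exact hU j
  exact fun x => LinearMap.congr_fun key x

theorem stdAddChar_neg_eq_star {k : ℕ} [NeZero k] (a : ZMod k) :
    ZMod.stdAddChar (-a) = star (ZMod.stdAddChar a : ℂ) :=
  AddChar.map_neg_eq_conj _ a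

section Prism

variable (k : ℕ) [NeZero k]

/-- The image in `ℤ/k * ℤ/2` of an element of `ℤ/k`. -/
def PrismGroup.rot (a : ZMod k) : PrismGroup k := Monoid.Coprod.inl (Multiplicative.ofAdd a)

omit [NeZero k] in
theorem PrismGroup.rot_zero : rot k 0 = 1 := map_one _

omit [NeZero k] in
theorem PrismGroup.rot_add (a b : ZMod k) : rot k (a + b) = rot k a * rot k b := by
  rw [rot, ofAdd_add, map_mul]; rfl

omit [NeZero k] in
theorem PrismGroup.rot_neg (a : ZMod k) : rot k (-a) = (rot k a)⁻¹ := by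
  rw [rot, ofAdd_neg, map_inv]; rfl

omit [NeZero k] in
theorem PrismGroup.w_pow_eq_rot (n : ℕ) : w k ^ n = rot k n := by
  rw [w, ← map_pow, Cyc.gen, ← ofAdd_nsmul, rot, nsmul_one]

theorem PrismGroup.rot_mem (a : ZMod k) :
    rot k a ∈ insert (v k) (Set.range fun j : Fin k => w k ^ (j : ℕ)) :=
  Or.inr ⟨⟨a.val, a.val_lt⟩, by simp [w_pow_eq_rot]⟩

/-- The power of `w` that an element of `ℤ/k` defines, as an element of `NCP(k)`. -/
def rotElt (a : ZMod k) : (NCP k).Elt :=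
  groupElt (PrismGroup.rot k a) (PrismGroup.rot_mem k a)

/-- The `i`-th spectral projection of the generator `w` of `ℤ/k`, as an element of `NCP(k)`. -/
def spectralProj (i : ZMod k) : (NCP k).Elt :=
  (k : ℂ)⁻¹ • ∑ a : ZMod k, (ZMod.stdAddChar (-(i * a)) : ℂ) • rotElt k a

theorem coe_spectralProj (i : ZMod k) : (spectralProj k i : GroupCStar (PrismGroup k)) =
    (k : ℂ)⁻¹ • ∑ a : ZMod k, (ZMod.stdAddChar (-(i * a)) : ℂ) •
      GroupCStar.of (PrismGroup.rot k a) := by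
  rw [spectralProj, Submodule.coe_smul, Submodule.coe_sum]
  rfl

theorem spectralProj_eq_star_mul_self (i : ZMod k) :
    (spectralProj k i : GroupCStar (PrismGroup k)) =
      star (spectralProj k i : GroupCStar (PrismGroup k)) * spectralProj k i := by
  have hk : (k : ℂ) ≠ 0 := NeZero.ne _
  rw [coe_spectralProj, star_smul, smul_mul_smul_comm, star_sum, Finset.sum_mul]
  have h : ∀ b : ZMod k,
      star ((ZMod.stdAddChar (-(i * b)) : ℂ) • GroupCStar.of (PrismGroup.rot k b)) *
        ∑ a : ZMod k, (ZMod.stdAddChar (-(i * a)) : ℂ) • GroupCStar.of (PrismGroup.rot k a) =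
      ∑ a : ZMod k, (ZMod.stdAddChar (-(i * a)) : ℂ) • GroupCStar.of (PrismGroup.rot k a) := by
    intro b
    rw [Finset.mul_sum, star_smul, ← stdAddChar_neg_eq_star, GroupCStar.star_of]
    refine Fintype.sum_equiv (Equiv.subRight b) _ _ fun a => ?_
    rw [smul_mul_smul_comm, ← map_mul GroupCStar.of, ← AddChar.map_add_eq_mul, ← PrismGroup.rot_neg,
      ← PrismGroup.rot_add, Equiv.subRight_apply]
    congr 3
    · ring
    · ring
  rw [Finset.sum_congr rfl fun b _ => h b, Finset.sum_const, Finset.card_univ, ZMod.card]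
  rw [← Nat.cast_smul_eq_nsmul ℂ, smul_smul]
  congr 1
  simp [hk]

theorem sum_smul_spectralProj (a : ZMod k) :
    ∑ i : ZMod k, (ZMod.stdAddChar (i * a) : ℂ) • spectralProj k i = rotElt k a := by
  have hk : (k : ℂ) ≠ 0 := NeZero.ne _
  simp only [spectralProj, Finset.smul_sum, smul_smul]
  rw [Finset.sum_comm]
  simp only [← Finset.sum_smul]
  have h : ∀ b : ZMod k, ∑ i : ZMod k, (ZMod.stdAddChar (i * a) : ℂ) * ((k : ℂ)⁻¹ *
      ZMod.stdAddChar (-(i * b))) = if b = a then 1 else 0 := by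
    intro b
    have h1 : ∀ i : ZMod k, (ZMod.stdAddChar (i * a) : ℂ) * ((k : ℂ)⁻¹ *
        ZMod.stdAddChar (-(i * b))) = (k : ℂ)⁻¹ * ZMod.stdAddChar (i * (a - b)) := by
      intro i
      rw [mul_sub, sub_eq_add_neg, AddChar.map_add_eq_mul]
      ring
    simp only [h1]
    rw [← Finset.mul_sum, AddChar.sum_mulShift _ (ZMod.isPrimitive_stdAddChar k), ZMod.card]
    simp only [sub_eq_zero, eq_comm (a := b)]
    split_ifs <;> simp [hk]
  simp only [h, ite_smul, one_smul, zero_smul, Finset.sum_ite_eq', Finset.mem_univ, if_true]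

variable {k}

section

variable (N) [PartialOrder N] [StarOrderedRing N]

/-- The diagonal unitary matrix whose `i`-th entry is `exp(2πi/k)^(i * a)`. -/
def diagPhase (a : ZMod k) : CStarMatrix (ZMod k) (ZMod k) N :=
  CStarMatrix.ofMatrix (Matrix.diagonal fun i => (ZMod.stdAddChar (i * a) : ℂ) • (1 : N))

omit [PartialOrder N] [StarOrderedRing N] in
theorem diagPhase_zero : diagPhase N (0 : ZMod k) = 1 := by
  ext i j
  simp [diagPhase, CStarMatrix.one_apply, Matrix.one_apply]

omit [PartialOrder N] [StarOrderedRing N] in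
theorem diagPhase_add (a b : ZMod k) :
    diagPhase N (a + b) = diagPhase N a * diagPhase N b := by
  ext i j
  simp only [diagPhase, CStarMatrix.ofMatrix_apply, CStarMatrix.mul_apply, Matrix.diagonal_apply]
  by_cases h : i = j
  · subst h
    simp [mul_add, AddChar.map_add_eq_mul, smul_smul, mul_comm]
  · simp [h]

omit [PartialOrder N] [StarOrderedRing N] in
theorem star_diagPhase (a : ZMod k) : star (diagPhase N a) = diagPhase N (-a) := by
  ext i j
  simp only [diagPhase, CStarMatrix.ofMatrix_apply, CStarMatrix.star_apply, Matrix.diagonal_apply]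
  by_cases h : i = j
  · subst h
    simp [star_smul, ← stdAddChar_neg_eq_star]
  · simp [h, Ne.symm h]

/-- The diagonal unitary representation of `ℤ/k` that contains each character once. -/
def diagRep : Cyc k →* unitary (CStarMatrix (ZMod k) (ZMod k) N) where
  toFun a := ⟨diagPhase N a.toAdd, by
    rw [Unitary.mem_iff, star_diagPhase, ← diagPhase_add, ← diagPhase_add]
    simp [diagPhase_zero]⟩
  map_one' := Subtype.ext (diagPhase_zero N)
  map_mul' a b := Subtype.ext (diagPhase_add N a.toAdd b.toAdd)

end

/-- The spectral measure of `w` is compressed to positive elements `P i = (V i)²` of sum `1`, and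
`V` is an isometric column that compresses the diagonal representation of `ℤ/k` to `φ`. The
self-adjoint contraction `V T V*`, where `T = φ v`, compresses to `T`, and is the corner of a
symmetry. -/
theorem NCP_exists_extension (φ : (NCP k).Elt →ₗ[ℂ] N) (hφ : (NCP k).IsUCP φ) :
    ∃ Φ : GroupCStar (PrismGroup k) →ₗ[ℂ] N, IsUCPMap Φ ∧ ∀ x : (NCP k).Elt, Φ x = φ x := by
  let _ := CStarAlgebra.spectralOrder N
  have := CStarAlgebra.spectralOrderedRing N
  let _ := CStarAlgebra.spectralOrder (GroupCStar (PrismGroup k))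
  have := CStarAlgebra.spectralOrderedRing (GroupCStar (PrismGroup k))
  have hv : PrismGroup.v k ∈
      insert (PrismGroup.v k) (Set.range fun j : Fin k => PrismGroup.w k ^ (j : ℕ)) := Or.inl rfl
  let T : N := φ (groupElt (PrismGroup.v k) hv)
  have hT : star T = T := (hφ.groupElt_involution hv (PrismGroup.v_inv k)).1
  have hT1 : T * T ≤ 1 := (hφ.groupElt_involution hv (PrismGroup.v_inv k)).2
  let S : N := CFC.sqrt (1 - T * T)
  have hS : S * S = 1 - T * T := CFC.sqrt_mul_sqrt_self _ (sub_nonneg.2 hT1)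
  have hS' : star S = S := (CFC.sqrt_nonneg _).isSelfAdjoint
  have hP : ∀ i : ZMod k, 0 ≤ φ (spectralProj k i) := fun i => hφ.map_nonneg <| by
    rw [spectralProj_eq_star_mul_self]
    exact star_mul_self_nonneg _
  let V : ZMod k → N := fun i => CFC.sqrt (φ (spectralProj k i))
  have hV : ∀ i, V i * V i = φ (spectralProj k i) := fun i => CFC.sqrt_mul_sqrt_self _ (hP i)
  have hV' : ∀ i, star (V i) = V i := fun i => (CFC.sqrt_nonneg _).isSelfAdjoint
  have hVw : ∀ a, ∑ i, (ZMod.stdAddChar (i * a) : ℂ) • (V i * V i) = φ (rotElt k a) := by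
    intro a
    simp only [hV, ← map_smul]
    rw [← map_sum, sum_smul_spectralProj]
  have hunit : rotElt k 0 = (NCP k).unit :=
    Subtype.ext ((congrArg GroupCStar.of (PrismGroup.rot_zero k)).trans (map_one _))
  have hV1 : ∑ i, V i * V i = 1 := by
    have := hVw 0
    rw [hunit, hφ.map_unit] at this
    simpa using this
  let Y : CStarMatrix (ZMod k) (ZMod k) N :=
    CStarMatrix.ofMatrix (Matrix.of fun i j => V i * T * V j)
  have hYs : IsSelfAdjoint Y := by
    ext i j
    simp [Y, CStarMatrix.star_apply, hV', hT, mul_assoc]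
  have hsum : ∀ a b c d : N, ∑ i, a * b * V i * (V i * c * d) = a * b * c * d := by
    intro a b c d
    have : ∀ i, a * b * V i * (V i * c * d) = a * b * (V i * V i) * (c * d) := by
      intro i; simp only [mul_assoc]
    simp only [this]
    rw [← Finset.sum_mul, ← Finset.mul_sum, hV1, mul_one, mul_assoc (a * b)]
  have hY1 : Y * Y ≤ 1 := by
    -- `1 - Y² = (1 - p) + V (1 - T²) V*`, where `p = V V*` is a projection; the matrix `z` has the
    -- row `S V*` on top and is zero elsewhere
    let p : CStarMatrix (ZMod k) (ZMod k) N :=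
      CStarMatrix.ofMatrix (Matrix.of fun i j => V i * V j)
    let z : CStarMatrix (ZMod k) (ZMod k) N :=
      CStarMatrix.ofMatrix (Matrix.of fun i j => if i = 0 then S * V j else 0)
    have hZ : 1 - Y * Y = star (1 - p) * (1 - p) + star z * z := by
      have hps : star p = p := by
        ext i j
        simp [p, CStarMatrix.star_apply, hV']
      have hpp : p * p = p := by
        ext i j
        simpa [p, CStarMatrix.mul_apply] using hsum (V i) 1 1 (V j)
      have hYY : Y * Y + star z * z = p := by
        ext i j
        have h1 : (Y * Y) i j = V i * T * T * V j := by
          simpa [Y, CStarMatrix.mul_apply] using hsum (V i) T T (V j)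
        have h2 : (star z * z) i j = V i * (S * S) * V j := by
          simp [z, CStarMatrix.mul_apply, CStarMatrix.star_apply, hV', hS', mul_assoc]
        rw [CStarMatrix.add_apply, h1, h2, hS]
        simp [p, mul_sub, sub_mul, mul_assoc]
      rw [star_sub, star_one, hps, sub_mul, mul_sub, mul_sub, hpp, one_mul, mul_one, one_mul,
        sub_self, sub_zero, ← hYY]
      abel
    rw [← sub_nonneg, hZ]
    exact add_nonneg (star_mul_self_nonneg _) (star_mul_self_nonneg _)
  obtain ⟨U, hU2, hU⟩ := exists_symmetry_dilation hYs hY1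
  let ρ : PrismGroup k →* unitary (CStarMatrix (Fin 2) (Fin 2) (CStarMatrix (ZMod k) (ZMod k) N)) :=
    Monoid.Coprod.lift
      ((Unitary.map (StarMonoidHom.ofClass
        (diagHom (D := CStarMatrix (ZMod k) (ZMod k) N)))).toMonoidHom.comp (diagRep N))
      (cycLift 2 U hU2)
  let Φ : GroupCStar (PrismGroup k) →ₗ[ℂ] N :=
    compression V ∘ₗ corner _ ∘ₗ (GroupCStar.lift ρ : GroupCStar (PrismGroup k) →ₗ[ℂ] _)
  refine ⟨Φ, (isUCPMap_compression V (by simp only [hV', hV1])).comp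
    (isUCPMap_corner.comp (isUCPMap_starAlgHom _)), ?_⟩
  have key : Φ ∘ₗ (NCP k).toSubmodule.subtype = φ := by
    refine eq_of_eq_groupElt fun g hg => ?_
    change compression V (corner _ (GroupCStar.lift ρ (GroupCStar.of g))) = _
    rw [GroupCStar.lift_of, corner_apply]
    obtain rfl | ⟨j, rfl⟩ := hg
    · have h1 : ρ (PrismGroup.v k) = U := by
        rw [PrismGroup.v, Monoid.Coprod.lift_apply_inr, cycLift_gen]
      rw [h1, hU]
      change ∑ i, ∑ j, star (V i) * (V i * T * V j) * V j = T
      have h2 : ∀ i j, star (V i) * (V i * T * V j) * V j = V i * V i * T * (V j * V j) := by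
        intro i j
        simp only [hV', mul_assoc]
      simp only [h2, ← Finset.mul_sum, ← Finset.sum_mul, hV1, mul_one, one_mul]
    · have h1 : (ρ (PrismGroup.rot k (j : ℕ)) : CStarMatrix (Fin 2) (Fin 2) _) 0 0 =
          diagPhase N ((j : ℕ) : ZMod k) := by
        rw [PrismGroup.rot, Monoid.Coprod.lift_apply_inl]
        rfl
      have h2 : ∀ h, (groupElt (PrismGroup.w k ^ (j : ℕ)) h : (NCP k).Elt) = rotElt k (j : ℕ) :=
        fun h => Subtype.ext (congrArg GroupCStar.of (PrismGroup.w_pow_eq_rot k j))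
      refine Eq.trans ?_ (congrArg φ (h2 _)).symm
      rw [← hVw]
      change compression V ((ρ (PrismGroup.w k ^ (j : ℕ)) : CStarMatrix (Fin 2) (Fin 2) _) 0 0) = _
      rw [PrismGroup.w_pow_eq_rot, h1]
      simp [compression, diagPhase, hV', Matrix.diagonal_apply]
  exact fun x => LinearMap.congr_fun key x

end Prism

end Extension

/-! ### Extension of positive functionals on matrices -/

section Riesz

/-- M. Riesz extension of a functional along a linear map that need not be injective. -/
theorem riesz_extension_map {E₀ E : Type*} [AddCommGroup E₀] [Module ℝ E₀] [AddCommGroup E]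
    [Module ℝ E] (T : E₀ →ₗ[ℝ] E) (F : E₀ →ₗ[ℝ] ℝ) (s : PointedCone ℝ E)
    (nonneg : ∀ x, T x ∈ s → 0 ≤ F x) (dense : ∀ y, ∃ x, T x + y ∈ s) :
    ∃ g : E →ₗ[ℝ] ℝ, (∀ x, g (T x) = F x) ∧ ∀ x ∈ s, 0 ≤ g x := by
  obtain ⟨σ, hσ⟩ := T.rangeRestrict.exists_rightInverse_of_surjective T.range_rangeRestrict
  have hσ' : ∀ y : LinearMap.range T, T (σ y) = y := fun y =>
    congrArg Subtype.val (LinearMap.congr_fun hσ y)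
  obtain ⟨g, hg, hgs⟩ := riesz_extension s ⟨LinearMap.range T, F ∘ₗ σ⟩
    (fun x hx => nonneg _ (by rwa [hσ' x]))
    (fun y => by
      obtain ⟨x, hx⟩ := dense y
      exact ⟨⟨T x, x, rfl⟩, hx⟩)
  refine ⟨g, fun x => ?_, hgs⟩
  have hker : ∀ z, T z = 0 → F z = 0 := fun z hz => by
    refine le_antisymm ?_ (nonneg z (by rw [hz]; exact zero_mem s))
    have := nonneg (-z) (by rw [map_neg, hz, neg_zero]; exact zero_mem s)
    simpa using this
  have h1 : g (T x) = F (σ ⟨T x, x, rfl⟩) := hg ⟨T x, x, rfl⟩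
  rw [h1, ← sub_eq_zero, ← map_sub]
  exact hker _ (by rw [map_sub, hσ', sub_self])

end Riesz

section Gram

variable {I : Type*} {C : Type*} [CStarAlgebra C]

/-- The matrix `ξ* η`, with entries `(ξ x)* (η y)`, of two finitely supported rows. -/
def gram : (I →₀ C) →ₗ[ℝ] (I →₀ C) →ₗ[ℝ] (I × I →₀ C) :=
  LinearMap.mk₂ ℝ
    (fun ξ η => ξ.sum fun x c => η.sum fun y d => Finsupp.single (x, y) (star c * d))
    (fun ξ ξ' η => Finsupp.sum_add_index' (by simp [Finsupp.sum])
      (by simp [Finsupp.sum, add_mul, Finset.sum_add_distrib]))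
    (fun t ξ η => by
      rw [Finsupp.sum_smul_index' (by simp [Finsupp.sum]), Finsupp.smul_sum]
      simp only [Finsupp.smul_sum, Finsupp.smul_single, star_smul, star_trivial, smul_mul_assoc])
    (fun ξ η η' => by
      rw [← Finsupp.sum_add]
      refine Finset.sum_congr rfl fun x _ => ?_
      exact Finsupp.sum_add_index' (by simp) (by simp [mul_add]))
    (fun t ξ η => by
      rw [Finsupp.smul_sum]
      refine Finset.sum_congr rfl fun x _ => ?_
      dsimp only
      rw [Finsupp.sum_smul_index' (by simp), Finsupp.smul_sum]
      simp only [Finsupp.smul_single, mul_smul_comm])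

theorem gram_single (x y : I) (c d : C) :
    gram (Finsupp.single x c) (Finsupp.single y d) = Finsupp.single (x, y) (star c * d) := by
  simp [gram]

theorem gram_apply (ξ η : I →₀ C) (p : I × I) : gram ξ η p = star (ξ p.1) * η p.2 := by
  classical
  induction ξ using Finsupp.induction_linear with
  | zero => simp
  | add ξ ξ' h h' => simp [h, h', add_mul]
  | single x c =>
    induction η using Finsupp.induction_linear with
    | zero => simp
    | add η η' h h' => rw [map_add, Finsupp.add_apply, h, h', Finsupp.add_apply, mul_add]
    | single y d =>
      rw [gram_single]
      simp only [Finsupp.single_apply, Prod.ext_iff]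
      by_cases h1 : x = p.1 <;> by_cases h2 : y = p.2 <;> simp [h1, h2]

/-- The adjoint of a finitely supported matrix over a space with involution `s`: the transpose, with
`s` applied to the entries. -/
def adj {V : Type*} [AddCommMonoid V] [Module ℝ V] (s : V →ₗ[ℝ] V) :
    (I × I →₀ V) →ₗ[ℝ] (I × I →₀ V) :=
  Finsupp.mapRange.linearMap s ∘ₗ (Finsupp.domLCongr (Equiv.prodComm I I)).toLinearMap

theorem adj_single {V : Type*} [AddCommMonoid V] [Module ℝ V] (s : V →ₗ[ℝ] V) (x y : I) (c : V) :
    adj s (Finsupp.single (x, y) c) = Finsupp.single (y, x) (s c) := by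
  simp [adj]

/-- The involution of a C*-algebra as a real linear map. -/
def starReal (C : Type*) [CStarAlgebra C] : C →ₗ[ℝ] C := (starL' ℝ : C ≃L[ℝ] C).toLinearMap

theorem starReal_apply (c : C) : starReal C c = star c := rfl

theorem adj_gram (ξ η : I →₀ C) : adj (starReal C) (gram ξ η) = gram η ξ := by
  induction ξ using Finsupp.induction_linear with
  | zero => simp
  | add ξ ξ' h h' => simp [h, h']
  | single x c =>
    induction η using Finsupp.induction_linear with
    | zero => simp
    | add η η' h h' => rw [map_add, map_add, h, h', map_add, LinearMap.add_apply]
    | single y d => rw [gram_single, adj_single, gram_single, starReal_apply, star_mul, star_star]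

/-- Left multiplication of a finitely supported row by an algebra element. -/
def leftMul (c : C) : (I →₀ C) →ₗ[ℝ] (I →₀ C) := Finsupp.mapRange.linearMap (LinearMap.mulLeft ℝ c)

theorem leftMul_single (c d : C) (x : I) :
    leftMul c (Finsupp.single x d) = Finsupp.single x (c * d) := by
  simp [leftMul]

/-- The cone generated by the matrices `ξ* ξ`, i.e. of the positive finitely supported
matrices. -/
def gramCone (I C : Type*) [CStarAlgebra C] : PointedCone ℝ (I × I →₀ C) :=
  Submodule.span _ (Set.range fun ξ : I →₀ C => gram ξ ξ)

theorem gram_mem_gramCone (ξ : I →₀ C) : gram ξ ξ ∈ gramCone I C :=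
  Submodule.subset_span ⟨ξ, rfl⟩

/-- The finite submatrices of a matrix in the cone are positive. -/
theorem matPos_of_mem_gramCone {M : I × I →₀ C} (hM : M ∈ gramCone I C) {n : ℕ} (e : Fin n → I) :
    MatPos (Matrix.of fun i j => M (e i, e j)) := by
  induction hM using Submodule.span_induction with
  | mem M hM =>
    obtain ⟨ξ, rfl⟩ := hM
    simp only [gram_apply]
    exact matPos_row fun i => ξ (e i)
  | zero => exact MatPos.zero n
  | add M M' _ _ h h' => exact h.add h'
  | smul t M _ h =>
    obtain ⟨N, hN⟩ := h
    have ht : ((Real.sqrt t : ℝ) * Real.sqrt t) = (t : ℝ) := Real.mul_self_sqrt t.2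
    refine ⟨(Real.sqrt t : ℝ) • N, ?_⟩
    rw [Matrix.conjTranspose_smul, Matrix.smul_mul, Matrix.mul_smul, smul_smul, ← hN]
    simp only [star_trivial, ht]
    rfl

/-- The cone of matrices whose real part is a sum of matrices `ξ* ξ`. -/
def realPartCone (I C : Type*) [CStarAlgebra C] : PointedCone ℝ (I × I →₀ C) :=
  (gramCone I C).comap (LinearMap.id + adj (starReal C))

theorem mem_realPartCone {M : I × I →₀ C} :
    M ∈ realPartCone I C ↔ M + adj (starReal C) M ∈ gramCone I C := Iff.rfl

theorem exists_star_mul_self_add (c : C) :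
    ∃ d : C, star c * c + star d * d = (‖c‖ ^ 2 : ℝ) • (1 : C) := by
  let _ := CStarAlgebra.spectralOrder C
  have := CStarAlgebra.spectralOrderedRing C
  have h : star c * c ≤ algebraMap ℝ C (‖c‖ ^ 2) := CStarAlgebra.star_mul_le_algebraMap_norm_sq
  obtain ⟨d, hd⟩ := CStarAlgebra.nonneg_iff_eq_star_mul_self.1 (sub_nonneg.2 h)
  exact ⟨d, by rw [← hd, Algebra.algebraMap_eq_smul_one]; abel⟩

end Gram

section Transport

variable {A C : Type*} [CStarAlgebra A] [CStarAlgebra C] {R : OpSystem A} {κ : R.Elt →ₗ[ℂ] C}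

/-- The involution of an operator system as a real linear map. -/
def OpSystem.starReal (R : OpSystem A) : R.Elt →ₗ[ℝ] R.Elt where
  toFun x := star x
  map_add' x y := Subtype.ext (star_add (x : A) y)
  map_smul' t x := Subtype.ext (by
    change star (((t : ℂ) • x : R.Elt) : A) = (((t : ℂ) • star x : R.Elt) : A)
    simp [OpSystem.coe_star, star_smul])

/-- A positive functional `f` on `A` defines the functional `M ↦ f (∑ x* M_{xy} y)` on the finitely
supported matrices over `R` with indices in `A`. As `κ` is a complete order embedding, it carries
over to the matrices over `κ(R)` as a positive functional, and extends to the matrices over `C`. -/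
theorem exists_matrix_functional [PartialOrder A] [StarOrderedRing A] (hκ : R.IsCStarCover κ)
    (f : A →ₗ[ℝ] ℝ) (hf : ∀ a, 0 ≤ a → 0 ≤ f a) (hfs : ∀ a, f (star a) = f a) :
    ∃ g : (A × A →₀ C) →ₗ[ℝ] ℝ,
      (∀ x y (r : R.Elt), g (Finsupp.single (x, y) (κ r)) = f (star x * r * y)) ∧
      ∀ ξ : A →₀ C, 0 ≤ g (gram ξ ξ) := by
  classical
  let T : (A × A →₀ R.Elt) →ₗ[ℝ] (A × A →₀ C) :=
    Finsupp.mapRange.linearMap (κ.restrictScalars ℝ)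
  let F : (A × A →₀ R.Elt) →ₗ[ℝ] ℝ := Finsupp.lsum ℝ fun p : A × A =>
    f ∘ₗ LinearMap.mulRight ℝ p.2 ∘ₗ LinearMap.mulLeft ℝ (star p.1) ∘ₗ
      (R.toSubmodule.subtype).restrictScalars ℝ
  have hT : ∀ (p : A × A) r, T (Finsupp.single p r) = Finsupp.single p (κ r) := by
    intro p r
    simp [T]
  have hF : ∀ (x y : A) (r : R.Elt), F (Finsupp.single (x, y) r) = f (star x * r * y) := by
    intro x y r
    simp [F]
  have hTadj : ∀ M, T (adj R.starReal M) = adj (starReal C) (T M) := by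
    intro M
    induction M using Finsupp.induction_linear with
    | zero => simp
    | add M M' h h' => simp [h, h']
    | single p r =>
      rw [adj_single, hT, hT, adj_single]
      exact congrArg _ (hκ.isUCP.map_star r)
  have hFadj : ∀ M, F (adj R.starReal M) = F M := by
    intro M
    induction M using Finsupp.induction_linear with
    | zero => simp
    | add M M' h h' => simp [h, h']
    | single p r =>
      rw [adj_single, hF, hF, ← hfs]
      simp [OpSystem.starReal, OpSystem.coe_star, mul_assoc]
  have hFpos : ∀ M, T M ∈ gramCone A C → 0 ≤ F M := by
    intro M hM
    let X : Finset A := M.support.image Prod.fst ∪ M.support.image Prod.snd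
    let e : Fin X.card ≃ X := X.equivFin.symm
    have h1 : R.Pos (Matrix.of fun i j => M ((e i : A), (e j : A))) := by
      refine (hκ.map_pos_iff _ _).1 ?_
      have := matPos_of_mem_gramCone hM fun i => (e i : A)
      exact this
    have h2 := MatPos.compress h1 fun i => (e i : A)
    have h3 : F M = f (∑ i, ∑ j, star (e i : A) * (M ((e i : A), (e j : A)) : A) * (e j : A)) := by
      have h4 : F M = ∑ p ∈ X ×ˢ X, f (star p.1 * M p * p.2) := by
        change M.sum (fun p r => f (star p.1 * r * p.2)) = _
        refine Finsupp.sum_of_support_subset M (fun p hp => ?_) _ (by simp)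
        exact Finset.mem_product.2
          ⟨Finset.mem_union_left _ (Finset.mem_image_of_mem _ hp),
            Finset.mem_union_right _ (Finset.mem_image_of_mem _ hp)⟩
      rw [h4, Finset.sum_product, map_sum, ← Finset.sum_coe_sort X]
      refine (Fintype.sum_equiv e _ _ fun i => ?_).symm
      rw [map_sum, ← Finset.sum_coe_sort X]
      exact Fintype.sum_equiv e _ _ fun j => rfl
    rw [h3]
    exact hf _ h2
  obtain ⟨g, hg, hgpos⟩ := riesz_extension_map T F (realPartCone A C)
    (fun M hM => by
      rw [mem_realPartCone, ← hTadj, ← map_add] at hM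
      have := hFpos _ hM
      rw [map_add, hFadj] at this
      linarith)
    (fun y => by
      induction y using Finsupp.induction_linear with
      | zero => exact ⟨0, by rw [map_zero, add_zero]; exact zero_mem _⟩
      | add y y' h h' =>
        obtain ⟨x, hx⟩ := h
        obtain ⟨x', hx'⟩ := h'
        refine ⟨x + x', ?_⟩
        rw [map_add, add_add_add_comm]
        exact add_mem hx hx'
      | single p c =>
        -- the real part is `(e_a + c e_b)* (e_a + c e_b) + (d e_b)* (d e_b)`
        obtain ⟨a, b⟩ := p
        obtain ⟨d, hd⟩ := exists_star_mul_self_add c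
        refine ⟨Finsupp.single (a, a) ((1 / 2 : ℝ) • R.unit) +
          Finsupp.single (b, b) ((‖c‖ ^ 2 / 2 : ℝ) • R.unit), ?_⟩
        have hu : ∀ t : ℝ, κ (t • R.unit) = t • (1 : C) := fun t => by
          rw [← hκ.map_unit]
          exact (κ.restrictScalars ℝ).map_smul t _
        rw [mem_realPartCone]
        convert add_mem (gram_mem_gramCone (Finsupp.single a 1 + Finsupp.single b c))
          (gram_mem_gramCone (Finsupp.single b d)) using 1
        have hd' : star d * d = (‖c‖ ^ 2 : ℝ) • (1 : C) - star c * c := by rw [← hd]; abel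
        have e1 : Finsupp.single (a, a) (1 : C) = Finsupp.single (a, a) ((1 / 2 : ℝ) • (1 : C)) +
            Finsupp.single (a, a) ((1 / 2 : ℝ) • (1 : C)) := by
          rw [← Finsupp.single_add, ← add_smul]; norm_num
        have e2 : Finsupp.single (b, b) ((‖c‖ ^ 2 : ℝ) • (1 : C)) =
            Finsupp.single (b, b) ((‖c‖ ^ 2 / 2 : ℝ) • (1 : C)) +
            Finsupp.single (b, b) ((‖c‖ ^ 2 / 2 : ℝ) • (1 : C)) := by
          rw [← Finsupp.single_add, ← add_smul, add_halves]
        simp only [map_add, LinearMap.add_apply, hT, hu, adj_single, gram_single, starReal_apply,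
          star_smul, star_one, star_trivial, one_mul, mul_one, hd', Finsupp.single_sub, e1, e2]
        abel)
  refine ⟨g, fun x y r => by rw [← hT, hg, hF], fun ξ => hgpos _ ?_⟩
  rw [mem_realPartCone, adj_gram]
  exact add_mem (gram_mem_gramCone ξ) (gram_mem_gramCone ξ)

end Transport

/-! ### Rigidity of unitaries in C*-covers -/

section Kernel

variable {V : Type*} [AddCommGroup V] [Module ℝ V] (β : V →ₗ[ℝ] V →ₗ[ℝ] ℝ)

/-- The vectors of length zero for a positive, not necessarily symmetric, bilinear form form a
subgroup, by the parallelogram law. -/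
def nullVectors (hβ : ∀ ξ, 0 ≤ β ξ ξ) : AddSubgroup V where
  carrier := {ξ | β ξ ξ = 0}
  zero_mem' := by simp
  add_mem' {ξ η} hξ hη := by
    have h1 := hβ (ξ + η)
    have h2 := hβ (ξ - η)
    simp only [Set.mem_ofPred_eq, map_add, map_sub, LinearMap.add_apply, LinearMap.sub_apply] at *
    linarith
  neg_mem' {ξ} hξ := by simpa using hξ

theorem mem_nullVectors {hβ : ∀ ξ, 0 ≤ β ξ ξ} {ξ : V} : ξ ∈ nullVectors β hβ ↔ β ξ ξ = 0 := Iff.rfl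

/-- Vectors that differ by a vector of length zero have the same length. -/
theorem apply_eq_of_sub_mem_nullVectors (hβ : ∀ ξ, 0 ≤ β ξ ξ) {ξ η : V}
    (h : ξ - η ∈ nullVectors β hβ) : β ξ ξ = β η η := by
  obtain ⟨ν, rfl⟩ : ∃ ν, ξ = η + ν := ⟨ξ - η, by abel⟩
  rw [add_sub_cancel_left, mem_nullVectors] at h
  have key : ∀ t : ℝ, 0 ≤ β η η + t * (β η ν + β ν η) := by
    intro t
    have := hβ (η + t • ν)
    simp only [map_add, map_smul, LinearMap.add_apply, LinearMap.smul_apply, h, smul_eq_mul] at this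
    linarith
  have hc : β η ν + β ν η = 0 := by
    by_contra hne
    have := key (-(β η η + 1) / (β η ν + β ν η))
    rw [div_mul_cancel₀ _ hne] at this
    linarith
  simp only [map_add, LinearMap.add_apply, h]
  linarith

end Kernel

section Rigidity

variable {A C : Type*} [CStarAlgebra A] [CStarAlgebra C] {R : OpSystem A} {κ : R.Elt →ₗ[ℂ] C}

/-- The graph of a unital complete order embedding, in the product of the C*-algebras. -/
def coverGraph (κ : R.Elt →ₗ[ℂ] C) : Set (A × C) := Set.range fun r : R.Elt => ((r : A), κ r)

/-- Every positive functional on `A` is dominated, on `a* a`, by the norm of `c` if `(a, c)` lies in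
the algebra generated by the graph of `κ`. For the positive form that the functional `g` defines on
the span of the vectors `c ⊗ y` with `c ∈ C` and `y ∈ A`, one has `κ(u) ⊗ y = 1 ⊗ u y`, up to a
vector of length zero, for the unitaries `u` that span `R`, because `κ(u)` is a contraction. Hence
`c ⊗ 1 = 1 ⊗ a` in the same sense. -/
theorem functional_le_of_mem_adjoin [PartialOrder A] [StarOrderedRing A] (hκ : R.IsCStarCover κ)
    {U : Set A} (hU : ∀ u ∈ U, u ∈ unitary A) (hR : R.toSubmodule = Submodule.span ℂ U)
    (f : A →ₗ[ℝ] ℝ) (hf : ∀ a, 0 ≤ a → 0 ≤ f a) (hfs : ∀ a, f (star a) = f a)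
    {p : A × C} (hp : p ∈ Algebra.adjoin ℂ (coverGraph κ)) :
    f (star p.1 * p.1) ≤ ‖p.2‖ ^ 2 * f 1 := by
  obtain ⟨g, hg, hpos⟩ := exists_matrix_functional hκ f hf hfs
  let β : (A →₀ C) →ₗ[ℝ] (A →₀ C) →ₗ[ℝ] ℝ := gram.compr₂ g
  have hβ : ∀ ξ, 0 ≤ β ξ ξ := hpos
  have hβs : ∀ x y (c d : C), β (Finsupp.single x c) (Finsupp.single y d) =
      g (Finsupp.single (x, y) (star c * d)) := fun x y c d =>
    congrArg g (gram_single x y c d)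
  have hg1 : ∀ x y (t : ℂ),
      g (Finsupp.single (x, y) (algebraMap ℂ C t)) = f (star x * (t • y)) := by
    intro x y t
    have := hg x y (t • R.unit)
    rw [map_smul, hκ.map_unit, ← Algebra.algebraMap_eq_smul_one] at this
    rw [this]
    simp [OpSystem.unit]
  -- left multiplication is bounded
  have hbound : ∀ (c : C) ξ, β (leftMul c ξ) (leftMul c ξ) ≤ ‖c‖ ^ 2 * β ξ ξ := by
    intro c ξ
    obtain ⟨d, hd⟩ := exists_star_mul_self_add c
    have h1 : gram (leftMul c ξ) (leftMul c ξ) + gram (leftMul d ξ) (leftMul d ξ) =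
        (‖c‖ ^ 2 : ℝ) • gram ξ ξ := by
      ext q
      simp only [Finsupp.add_apply, gram_apply, leftMul, Finsupp.smul_apply,
        Finsupp.mapRange.linearMap_apply, Finsupp.mapRange_apply, LinearMap.mulLeft_apply]
      have h2 : ∀ b : C, star (b * ξ q.1) * (b * ξ q.2) = star (ξ q.1) * (star b * b) * ξ q.2 := by
        intro b
        simp only [star_mul, mul_assoc]
      rw [h2, h2, ← add_mul, ← mul_add, hd, mul_smul_comm, mul_one, smul_mul_assoc]
    have h2 := congrArg g h1
    rw [map_add, map_smul, smul_eq_mul] at h2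
    have h3 : 0 ≤ β (leftMul d ξ) (leftMul d ξ) := hβ _
    change g _ ≤ _ * g _
    change 0 ≤ g _ at h3
    linarith
  have hmul : ∀ (c : C) {ξ}, ξ ∈ nullVectors β hβ → leftMul c ξ ∈ nullVectors β hβ := by
    intro c ξ hξ
    rw [mem_nullVectors] at *
    refine le_antisymm ?_ (hβ _)
    simpa [hξ] using hbound c ξ
  -- `1 ⊗ y` depends additively on `y`, and scalars move through the tensor sign
  have hadd : ∀ x y : A, Finsupp.single (x + y) (1 : C) - Finsupp.single x 1 - Finsupp.single y 1 ∈
      nullVectors β hβ := by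
    intro x y
    have h1 : ∀ z w : A, β (Finsupp.single z 1) (Finsupp.single w 1) = f (star z * w) := by
      intro z w
      rw [hβs, star_one, one_mul]
      simpa using hg1 z w 1
    rw [mem_nullVectors]
    simp only [map_sub, LinearMap.sub_apply, h1, star_add, add_mul, mul_add, map_add]
    ring
  have hsmul : ∀ (t : ℂ) (y : A), Finsupp.single y (algebraMap ℂ C t) - Finsupp.single (t • y) 1 ∈
      nullVectors β hβ := by
    intro t y
    have h1 : ∀ (z w : A) (r s : ℂ),
        β (Finsupp.single z (algebraMap ℂ C r)) (Finsupp.single w (algebraMap ℂ C s)) =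
          f (star (r • z) * (s • w)) := by
      intro z w r s
      rw [hβs, ← algebraMap_star_comm, ← map_mul, hg1]
      simp [star_smul, smul_smul, mul_comm]
    rw [mem_nullVectors, ← map_one (algebraMap ℂ C)]
    simp only [map_sub, LinearMap.sub_apply, h1, one_smul]
    ring
  -- the pairs `(a, c)` for which `c ⊗ y = 1 ⊗ a y` for all `y` form an algebra
  let P : A × C → Prop := fun q => ∀ y : A,
    Finsupp.single y q.2 - Finsupp.single (q.1 * y) 1 ∈ nullVectors β hβ
  have hPadd : ∀ q q', P q → P q' → P (q + q') := by
    intro q q' h h' y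
    have := (nullVectors β hβ).sub_mem (add_mem (h y) (h' y)) (hadd (q.1 * y) (q'.1 * y))
    convert this using 1
    rw [Prod.snd_add, Prod.fst_add, Finsupp.single_add, add_mul]
    abel
  have hPmul : ∀ q q', P q → P q' → P (q * q') := by
    intro q q' h h' y
    have := add_mem (hmul q.2 (h' y)) (h (q'.1 * y))
    convert this using 1
    rw [map_sub, leftMul_single, leftMul_single, Prod.snd_mul, Prod.fst_mul, mul_one, mul_assoc]
    abel
  have hPalg : ∀ t : ℂ, P (algebraMap ℂ (A × C) t) := by
    intro t y
    have := hsmul t y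
    rwa [Algebra.smul_def] at this
  have hPsmul : ∀ (t : ℂ) q, P q → P (t • q) := by
    intro t q h
    rw [Algebra.smul_def]
    exact hPmul _ _ (hPalg t) h
  have hPunit : ∀ u : R.Elt, (u : A) ∈ U → P (u, κ u) := by
    intro u hu y
    obtain ⟨hu1, -⟩ := Unitary.mem_iff.1 (hU u hu)
    rw [mem_nullVectors]
    refine le_antisymm ?_ (hβ _)
    have hu1' : ∀ z : A, star (u : A) * ((u : A) * z) = z := fun z => by
      rw [← mul_assoc, hu1, one_mul]
    have e1 : β (Finsupp.single y (κ u)) (Finsupp.single y (κ u)) ≤ f (star y * y) := by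
      let _ := CStarAlgebra.spectralOrder C
      have := CStarAlgebra.spectralOrderedRing C
      obtain ⟨d, hd⟩ := CStarAlgebra.nonneg_iff_eq_star_mul_self.1
        (sub_nonneg.2 (hκ.isUCP.star_mul_self_le_one u hu1))
      have h1 := hβ (Finsupp.single y d)
      rw [hβs, ← hd, Finsupp.single_sub, map_sub] at h1
      have h2 := hg1 y y 1
      rw [map_one, one_smul] at h2
      rw [hβs]
      linarith
    have e2 : β (Finsupp.single y (κ u)) (Finsupp.single (u * y) 1) = f (star y * y) := by
      rw [hβs, mul_one, ← hκ.isUCP.map_star, hg, OpSystem.coe_star, mul_assoc, hu1']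
    have e3 : β (Finsupp.single ((u : A) * y) 1) (Finsupp.single y (κ u)) = f (star y * y) := by
      rw [hβs, star_one, one_mul, hg, star_mul, mul_assoc, mul_assoc, hu1']
    have e4 : β (Finsupp.single ((u : A) * y) 1) (Finsupp.single ((u : A) * y) 1) =
        f (star y * y) := by
      rw [hβs, star_one, one_mul]
      have h2 := hg1 (u * y) (u * y) 1
      rw [map_one, one_smul] at h2
      rw [h2, star_mul, mul_assoc, hu1']
    simp only [map_sub, LinearMap.sub_apply, e2, e3, e4]
    linarith
  have hPR : ∀ r : R.Elt, P (r, κ r) := by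
    rintro ⟨r, hr⟩
    have hr' := hr
    rw [hR] at hr'
    have hUR : ∀ {x}, x ∈ Submodule.span ℂ U → x ∈ R.toSubmodule := fun h => by rwa [hR]
    have : ∀ (h : r ∈ Submodule.span ℂ U), P (r, κ ⟨r, hUR h⟩) := by
      intro h
      clear hr hr'
      induction h using Submodule.span_induction with
      | mem u hu => exact hPunit ⟨u, hUR (Submodule.subset_span hu)⟩ hu
      | zero =>
        have h0 := hPalg 0
        rw [map_zero] at h0
        have : κ ⟨0, hUR (zero_mem _)⟩ = 0 := map_zero κ
        rwa [this]
      | add x y hx hy h h' =>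
        have := hPadd _ _ h h'
        rwa [Prod.mk_add_mk, ← map_add] at this
      | smul t x hx h =>
        have := hPsmul t _ h
        rwa [Prod.smul_mk, ← map_smul] at this
    exact this hr'
  have hPp : P p := by
    induction hp using Algebra.adjoin_induction with
    | mem x hx =>
      obtain ⟨r, rfl⟩ := hx
      exact hPR r
    | algebraMap t => exact hPalg t
    | add x y _ _ h h' => exact hPadd _ _ h h'
    | mul x y _ _ h h' => exact hPmul _ _ h h'
  have h1 := apply_eq_of_sub_mem_nullVectors β hβ (hPp 1)
  have h2 := hbound p.2 (Finsupp.single 1 1)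
  have hone : ∀ x : A, β (Finsupp.single x 1) (Finsupp.single x 1) = f (star x * x) := by
    intro x
    rw [hβs, star_one, one_mul]
    simpa using hg1 x x 1
  rw [leftMul_single, mul_one, h1, mul_one, hone, hone, star_one, one_mul] at h2
  exact h2

/-- Were `‖c‖² - a* a` not positive, a functional separating it from the closed cone of positive
elements would contradict `functional_le_of_mem_adjoin`. -/
theorem norm_le_of_mem_adjoin (hκ : R.IsCStarCover κ)
    {U : Set A} (hU : ∀ u ∈ U, u ∈ unitary A) (hR : R.toSubmodule = Submodule.span ℂ U)
    {p : A × C} (hp : p ∈ Algebra.adjoin ℂ (coverGraph κ)) : ‖p.1‖ ≤ ‖p.2‖ := by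
  let _ := CStarAlgebra.spectralOrder A
  have := CStarAlgebra.spectralOrderedRing A
  let K : ProperCone ℝ A :=
    { carrier := {a | 0 ≤ a}
      add_mem' := fun {a b} (ha : 0 ≤ a) (hb : 0 ≤ b) => add_nonneg ha hb
      zero_mem' := le_refl (0 : A)
      smul_mem' := fun t a (ha : 0 ≤ a) => show (0 : A) ≤ (t : ℝ) • a from smul_nonneg t.2 ha
      isClosed' := CStarAlgebra.isClosed_nonneg }
  have h : 0 ≤ algebraMap ℝ A (‖p.2‖ ^ 2) - star p.1 * p.1 := by
    by_contra hneg
    obtain ⟨f, hf, hf0⟩ := K.hyperplane_separation_point hneg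
    -- the separating functional, symmetrized
    let F : A →ₗ[ℝ] ℝ := f.toLinearMap ∘ₗ (LinearMap.id + starReal A)
    have hF : ∀ a, F a = f a + f (star a) := fun a => map_add f a (star a)
    have h1 := functional_le_of_mem_adjoin hκ hU hR F
      (fun a ha => by
        rw [hF]
        have : star a = a := ha.isSelfAdjoint
        rw [this]
        exact add_nonneg (hf a ha) (hf a ha))
      (fun a => by rw [hF, hF, star_star, add_comm]) hp
    rw [hF, hF, star_mul, star_star, star_one] at h1
    rw [map_sub, Algebra.algebraMap_eq_smul_one, map_smul, smul_eq_mul] at hf0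
    linarith
  have h2 : ‖star p.1 * p.1‖ ≤ ‖p.2‖ ^ 2 :=
    (CStarAlgebra.norm_le_iff_le_algebraMap _ (by positivity) (star_mul_self_nonneg _)).2
      (sub_nonneg.1 h)
  rw [CStarRing.norm_star_mul_self, ← sq] at h2
  exact (sq_le_sq₀ (norm_nonneg _) (norm_nonneg _)).1 h2

/-- An operator system `R` that is spanned by unitaries which generate `A` is rigid: every
C*-cover of `R` has a quotient map onto `A` over `R`. -/
theorem exists_starAlgHom_of_isCStarCover (hκ : R.IsCStarCover κ)
    {U : Set A} (hU : ∀ u ∈ U, u ∈ unitary A) (hR : R.toSubmodule = Submodule.span ℂ U) :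
    ∃ π : C →⋆ₐ[ℂ] A, ∀ x, π (κ x) = x := by
  let D : StarSubalgebra ℂ (A × C) := (StarAlgebra.adjoin ℂ (coverGraph κ)).topologicalClosure
  have hDclosed : IsClosed (D : Set (A × C)) := StarSubalgebra.isClosed_topologicalClosure _
  have hadj : (StarAlgebra.adjoin ℂ (coverGraph κ) : Set (A × C)) =
      Algebra.adjoin ℂ (coverGraph κ) := by
    have : coverGraph κ ∪ star (coverGraph κ) = coverGraph κ := by
      refine Set.union_eq_self_of_subset_right ?_
      rintro ⟨a, c⟩ ⟨r, hr⟩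
      refine ⟨star r, ?_⟩
      have h1 : ((r : A), κ r) = (star a, star c) := hr
      rw [Prod.mk.injEq] at h1
      simp only [OpSystem.coe_star, hκ.isUCP.map_star, h1.1, h1.2, star_star]
    have h2 := StarAlgebra.adjoin_toSubalgebra ℂ (coverGraph κ)
    rw [this] at h2
    exact congrArg (fun S : Subalgebra ℂ (A × C) => (S : Set (A × C))) h2
  have hnorm : ∀ p ∈ D, ‖p.1‖ ≤ ‖p.2‖ := by
    have : IsClosed {p : A × C | ‖p.1‖ ≤ ‖p.2‖} :=
      isClosed_le continuous_fst.norm continuous_snd.norm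
    intro p hp
    refine closure_minimal (fun q hq => ?_) this hp
    rw [hadj] at hq
    exact norm_le_of_mem_adjoin hκ hU hR hq
  let sndD : D →⋆ₐ[ℂ] C := (StarAlgHom.snd ℂ A C).comp D.subtype
  let fstD : D →⋆ₐ[ℂ] A := (StarAlgHom.fst ℂ A C).comp D.subtype
  have hiso : Isometry sndD := by
    refine AddMonoidHomClass.isometry_of_norm sndD fun p => ?_
    exact (max_eq_right (hnorm p p.2)).symm
  have hgraph : ∀ r : R.Elt, ((r : A), κ r) ∈ D := fun r =>
    subset_closure (StarAlgebra.subset_adjoin ℂ _ ⟨r, rfl⟩)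
  have hsurj : Function.Surjective sndD := by
    have hcl : IsClosed (Set.range sndD) := by
      have := hDclosed.completeSpace_coe
      exact hiso.isClosedEmbedding.isClosed_range
    have hle : (StarAlgebra.adjoin ℂ (Set.range κ)).topologicalClosure ≤ sndD.range := by
      refine StarSubalgebra.topologicalClosure_minimal (StarAlgebra.adjoin_le ?_) hcl
      rintro _ ⟨r, rfl⟩
      exact ⟨⟨_, hgraph r⟩, rfl⟩
    rw [hκ.generates] at hle
    exact fun c => hle (show c ∈ (⊤ : StarSubalgebra ℂ C) from trivial)
  let e : D ≃⋆ₐ[ℂ] C := StarAlgEquiv.ofBijective sndD ⟨hiso.injective, hsurj⟩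
  refine ⟨fstD.comp (e.symm : C →⋆ₐ[ℂ] D), fun r => ?_⟩
  have : e.symm (κ r) = ⟨_, hgraph r⟩ := by
    rw [StarAlgEquiv.symm_apply_eq]
    rfl
  change fstD (e.symm (κ r)) = r
  rw [this]
  rfl

end Rigidity

/-! ### Operator systems spanned by a generating set of a group -/

section Main

theorem isCStarCover_subtype {G : Type*} [Group G] {S : Set G} (h1 : (1 : G) ∈ S)
    (hinv : ∀ g ∈ S, g⁻¹ ∈ S) (hS : Subgroup.closure S = ⊤) :
    (GroupCStar.spanOpSystem S h1 hinv).IsCStarCover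
      (GroupCStar.spanOpSystem S h1 hinv).toSubmodule.subtype where
  map_unit := rfl
  map_pos_iff _ _ := Iff.rfl
  generates := by
    refine GroupCStar.topologicalClosure_eq_top _ fun g => ?_
    have hg : g ∈ Subgroup.closure S := hS ▸ Subgroup.mem_top g
    induction hg using Subgroup.closure_induction with
    | mem g hg => exact StarAlgebra.subset_adjoin ℂ _ ⟨groupElt g hg, rfl⟩
    | one => rw [map_one]; exact one_mem _
    | mul g h _ _ hg hh => rw [map_mul]; exact mul_mem hg hh
    | inv g _ hg => rw [← GroupCStar.star_of]; exact star_mem hg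

/-- An operator system spanned by a generating set of a group has `C*(G)` as its C*-envelope. If
its unital completely positive maps into an arbitrary C*-algebra `N` extend to `C*(G)` with values
in `N`, this applies to `N = φ(R)''`. -/
theorem hasControlledExtensions_of_extension.{a, b, c} {G : Type a} [Group G] {S : Set G}
    (h1 : (1 : G) ∈ S) (hinv : ∀ g ∈ S, g⁻¹ ∈ S) (hS : Subgroup.closure S = ⊤)
    (hext : ∀ (N : Type c) [CStarAlgebra N]
      (φ : (GroupCStar.spanOpSystem S h1 hinv).Elt →ₗ[ℂ] N),
      (GroupCStar.spanOpSystem S h1 hinv).IsUCP φ → ∃ Φ : GroupCStar G →ₗ[ℂ] N, IsUCPMap Φ ∧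
        ∀ x : (GroupCStar.spanOpSystem S h1 hinv).Elt, Φ x = φ x) :
    HasControlledExtensions.{a, b, c} (GroupCStar.spanOpSystem S h1 hinv) := by
  have hU : ∀ u ∈ GroupCStar.of '' S, u ∈ unitary (GroupCStar G) := by
    rintro _ ⟨g, -, rfl⟩
    exact GroupCStar.of_mem_unitary g
  refine ⟨⟨GroupCStar G, inferInstance, (GroupCStar.spanOpSystem S h1 hinv).toSubmodule.subtype,
    isCStarCover_subtype h1 hinv hS,
    fun C _ κ hκ => exists_starAlgHom_of_isCStarCover hκ hU rfl⟩, ?_⟩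
  intro B _ ι hι H _ _ _ φ hφ
  obtain ⟨π, hπ⟩ := exists_starAlgHom_of_isCStarCover hι.isCover hU rfl
  let M : StarSubalgebra ℂ (H →L[ℂ] H) :=
    StarSubalgebra.centralizer ℂ (Set.centralizer (Set.range φ))
  have hstar : star (Set.centralizer (Set.range φ)) = Set.centralizer (Set.range φ) := by
    rw [Set.star_centralizer]
    congr 1
    ext x
    constructor
    · rintro ⟨r, hr⟩
      exact ⟨star r, by rw [hφ.map_star, hr, star_star]⟩
    · rintro ⟨r, rfl⟩
      exact ⟨star r, hφ.map_star r⟩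
  have hM : (M : Set (H →L[ℂ] H)) = Set.centralizer (Set.centralizer (Set.range φ)) := by
    rw [StarSubalgebra.coe_centralizer, hstar, Set.union_self]
  have : IsClosed (M : Set (H →L[ℂ] H)) := by
    rw [hM]
    exact Set.isClosed_centralizer _
  have hmem : ∀ x, φ x ∈ M := fun x => by
    rw [← SetLike.mem_coe, hM]
    exact Set.subset_centralizer_centralizer ⟨x, rfl⟩
  let φM : (GroupCStar.spanOpSystem S h1 hinv).Elt →ₗ[ℂ] M :=
    { toFun := fun x => ⟨φ x, hmem x⟩
      map_add' := fun x y => Subtype.ext (map_add φ x y)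
      map_smul' := fun c x => Subtype.ext (map_smul φ c x) }
  have hφM : (GroupCStar.spanOpSystem S h1 hinv).IsUCP φM :=
    ⟨Subtype.ext hφ.map_unit, fun n X hX =>
      MatPos.of_map M.subtype Subtype.val_injective (hφ.map_pos n X hX)⟩
  obtain ⟨Φ, hΦ, hΦφ⟩ := hext M φM hφM
  refine ⟨(M.subtype : M →ₗ[ℂ] (H →L[ℂ] H)) ∘ₗ Φ ∘ₗ (π : B →ₗ[ℂ] GroupCStar G),
    (isUCPMap_starAlgHom _).comp (hΦ.comp (isUCPMap_starAlgHom _)), fun b => ?_, fun x => ?_⟩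
  · rw [← hM]
    exact (Φ (π b)).2
  · change ((Φ (π (ι x)) : M) : H →L[ℂ] H) = φ x
    rw [hπ, hΦφ]
    rfl

theorem exists_gen_pow_eq (k : ℕ) [NeZero k] (a : Cyc k) : ∃ n : ℕ, a = Cyc.gen k ^ n :=
  ⟨a.toAdd.val, by rw [Cyc.gen, ← ofAdd_nsmul, nsmul_one, ZMod.natCast_zmod_val]; rfl⟩

theorem CubeGroup.closure_eq_top (d : ℕ) :
    Subgroup.closure (insert (1 : CubeGroup d) (Set.range CubeGroup.u)) = ⊤ := by
  refine (Subgroup.eq_top_iff' _).2 fun g => ?_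
  induction g using Monoid.CoprodI.induction_on with
  | one => exact one_mem _
  | of i m =>
    obtain ⟨n, rfl⟩ := exists_gen_pow_eq 2 m
    rw [map_pow]
    have hu : CubeGroup.u i ∈ Subgroup.closure (insert (1 : CubeGroup d) (Set.range CubeGroup.u)) :=
      Subgroup.subset_closure (Or.inr ⟨i, rfl⟩)
    exact pow_mem hu n
  | mul g h hg hh => exact mul_mem hg hh

theorem PrismGroup.closure_eq_top (k : ℕ) [NeZero k] :
    Subgroup.closure (insert (PrismGroup.v k)
      (Set.range fun j : Fin k => PrismGroup.w k ^ (j : ℕ))) = ⊤ := by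
  refine (Subgroup.eq_top_iff' _).2 fun g => ?_
  induction g using Monoid.Coprod.induction_on with
  | inl a => exact Subgroup.subset_closure (PrismGroup.rot_mem k a.toAdd)
  | inr a =>
    obtain ⟨n, rfl⟩ := exists_gen_pow_eq 2 a
    rw [map_pow]
    have hv : PrismGroup.v k ∈ Subgroup.closure (insert (PrismGroup.v k)
        (Set.range fun j : Fin k => PrismGroup.w k ^ (j : ℕ))) :=
      Subgroup.subset_closure (Or.inl rfl)
    exact pow_mem hv n
  | mul g h hg hh => exact mul_mem hg hh

end Main

end NCCube

end

theorem mainTheorem7 :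
    (∀ d : ℕ, 1 ≤ d → NCCube.HasControlledExtensions.{0, v, w} (NCCube.NC d)) ∧
    (∀ (k : ℕ) [NeZero k], NCCube.HasControlledExtensions.{0, v, w} (NCCube.NCP k)) :=
  ⟨fun d _ => NCCube.hasControlledExtensions_of_extension _ _ (NCCube.CubeGroup.closure_eq_top d)
      fun _ _ φ hφ => NCCube.NC_exists_extension d φ hφ,
    fun k _ => NCCube.hasControlledExtensions_of_extension _ _ (NCCube.PrismGroup.closure_eq_top k)
      fun _ _ φ hφ => NCCube.NCP_exists_extension φ hφ⟩
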